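/- Theorem 3.1. Let $X$ and $U$ be (real or complex) Hilbert spaces, and let $A:D(A)\subset X\to X$ generate an analytic semigroup $\{S(t)\}_{t\ge 0}$ on $X$ (for real $X$: its complexification is analytic). Let $X_{-1}\supset X$ be the dual of $D(A^*)$ (with the graph norm) with respect to the pivot space $X$, and denote the extension of $S(t)$ to $X_{-1}$ by $S(t)$ again. Let $B\in\mathcal L(U,X_{-1})$ be an admissible control operator, i.e. there is a $\tau>0$ such that $\int_0^\tau S(\tau-t)Bf(t)\,dt\in X$ for all $f\in L^2(0,\tau;U)$, and let $B^*\in\mathcal L(D(A^*),U)$ be its adjoint. Assume that there are constants $d,k>0$ such that $$\|S(L)^*\varphi\|_X^2\le e^{d/L^k}\int_0^L\|B^*S(t)^*\varphi\|_U^2\,dt\qquad\text{for all }\varphi\in D(A^*),\ L\in(0,1].$$ Let $z_0,z_1\in X$ with $z_1\ne z_0$ and let $M>0$. For measurable $f:(0,\infty)\to U$ with $f\in L^2_{loc}([0,\infty);U)$ let $$z(t;f)=S(t)z_0+\int_0^tS(t-s)Bf(s)\,ds,\qquad t\ge 0,$$ be the solution of $z'=Az+Bf$, $z(0)=z_0$.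 Let $\mathcal U_M$ be the set of measurable $f:(0,\infty)\to U$ with $\|f(t)\|_U\le M$ for a.e. $t>0$, and let $$T(M)=\inf\{t>0:\ z(t;f)=z_1\text{ for some }f\in\mathcal U_M\}.$$ Then the time optimal control problem has the bang-bang property: if this set of times is non-empty, every optimal control, i.e. every $f^*\in\mathcal U_M$ with $z(T(M);f^*)=z_1$, satisfies $\|f^*(t)\|_U=M$ for a.e. $t\in(0,T(M))$. -/

import Mathlib

open Filter Topology MeasureTheory
open scoped NNReal

noncomputable section

universe u v

/-- A strongly continuous (`C₀`) semigroup of bounded linear operators on `X`. -/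
structure C0Semigroup (𝕜 : Type*) [RCLike 𝕜] (X : Type u) [NormedAddCommGroup X]
    [InnerProductSpace 𝕜 X] where
  /-- the operators `S(t)`, `t ≥ 0` -/
  op : ℝ≥0 → X →L[𝕜] X
  op_zero : op 0 = ContinuousLinearMap.id 𝕜 X
  op_add : ∀ s t : ℝ≥0, op (s + t) = (op s).comp (op t)
  continuous_orbit : ∀ x : X, Continuous fun t : ℝ≥0 => op t x

/-- The open sector `{z ≠ 0 : |arg z| < θ}` of the complex plane (for `0 < θ ≤ π`). -/
def openSector (θ : ℝ) : Set ℂ := {z | z ≠ 0 ∧ |z.arg| < θ}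

/-- `T` is an analytic semigroup in the sector `|arg z| < θ` on the complex Banach space `Y`:
it is holomorphic there for the operator norm, satisfies the semigroup law, and
`T z y → y` as `z → 0` inside the sector. -/
structure IsSectorialSemigroup {Y : Type*} [NormedAddCommGroup Y] [NormedSpace ℂ Y]
    (θ : ℝ) (T : ℂ → Y →L[ℂ] Y) : Prop where
  holomorphic : DifferentiableOn ℂ T (openSector θ)
  zero : T 0 = ContinuousLinearMap.id ℂ Y
  add : ∀ z ∈ openSector θ, ∀ w ∈ openSector θ, T (z + w) = (T z).comp (T w)
  tendsto : ∀ y : Y, Tendsto (fun z => T z y) (𝓝[openSector θ] 0) (𝓝 y)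

namespace C0Semigroup

variable {𝕜 : Type*} [RCLike 𝕜] {X : Type u} [NormedAddCommGroup X] [InnerProductSpace 𝕜 X]
  (S : C0Semigroup 𝕜 X)

/-- `S` is an analytic semigroup: it extends to an analytic semigroup `T` in a sector around
the positive half-line, on a complex Banach space `Y = X + iX`. For complex `X` one takes
`Y = X` (and `ι` the identity), for real `X` the complexification `Y = X ⊕ iX`. The isometric
real-linear map `ι : X → Y` is the inclusion. -/
def IsAnalytic : Prop :=
  ∃ (Y : Type u) (_ : NormedAddCommGroup Y) (_ : NormedSpace ℂ Y) (_ : CompleteSpace Y)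
    (ι : X →+ Y) (θ : ℝ) (T : ℂ → Y →L[ℂ] Y),
    (∀ x, ‖ι x‖ = ‖x‖) ∧
    (∀ (r : ℝ) (x : X), ι ((r : 𝕜) • x) = (r : ℂ) • ι x) ∧
    (∀ y, ∃ x₁ x₂, y = ι x₁ + Complex.I • ι x₂) ∧
    0 < θ ∧ θ ≤ Real.pi / 2 ∧ IsSectorialSemigroup θ T ∧
    ∀ (t : ℝ≥0) (x : X), T ((t : ℝ) : ℂ) (ι x) = ι (S.op t x)

/-- `y = lim_{h ↓ 0} (S(h) x - x) / h`. -/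
def HasGeneratorValue (x y : X) : Prop :=
  Tendsto (fun h : ℝ≥0 => (((h : ℝ) : 𝕜))⁻¹ • (S.op h x - x)) (𝓝[>] 0) (𝓝 y)

/-- The infinitesimal generator `A` of the semigroup, with
`D(A) = {x : lim_{h ↓ 0} (S(h) x - x) / h exists}`. -/
def generator : X →ₗ.[𝕜] X where
  domain :=
    { carrier := {x | ∃ y, S.HasGeneratorValue x y}
      zero_mem' := ⟨0, by simp [HasGeneratorValue]⟩
      add_mem' := by
        rintro a b ⟨y, hy⟩ ⟨w, hw⟩
        refine ⟨y + w, (hy.add hw).congr fun h => ?_⟩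
        rw [← smul_add, map_add]
        congr 1
        abel
      smul_mem' := by
        rintro c a ⟨y, hy⟩
        refine ⟨c • y, (hy.const_smul c).congr fun h => ?_⟩
        rw [map_smul, ← smul_sub, smul_comm] }
  toFun :=
    { toFun := fun x => Classical.choose x.2
      map_add' := fun a b => by
        refine tendsto_nhds_unique (Classical.choose_spec (a + b).2) ?_
        refine ((Classical.choose_spec a.2).add (Classical.choose_spec b.2)).congr fun h => ?_
        rw [← smul_add, Submodule.coe_add, map_add]
        congr 1
        abel
      map_smul' := fun c a => by
        refine tendsto_nhds_unique (Classical.choose_spec (c • a).2) ?_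
        refine ((Classical.choose_spec a.2).const_smul c).congr fun h => ?_
        rw [Submodule.coe_smul, map_smul, ← smul_sub, smul_comm] }

theorem generator_spec (x : S.generator.domain) :
    S.HasGeneratorValue (x : X) (S.generator x) :=
  Classical.choose_spec x.2

theorem generator_eq {x y : X} (h : S.HasGeneratorValue x y) :
    ∃ hx : x ∈ S.generator.domain, S.generator ⟨x, hx⟩ = y :=
  ⟨⟨y, h⟩, tendsto_nhds_unique (S.generator_spec ⟨x, ⟨y, h⟩⟩) h⟩

/-- `S(t)` maps `D(A)` into itself and commutes with `A` there. -/
theorem generator_op (t : ℝ≥0) (x : S.generator.domain) :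
    ∃ hx : S.op t x ∈ S.generator.domain,
      S.generator ⟨S.op t x, hx⟩ = S.op t (S.generator x) := by
  apply S.generator_eq
  refine (((S.op t).continuous.tendsto _).comp (S.generator_spec x)).congr fun h => ?_
  have h1 : S.op h (S.op t x) = S.op t (S.op h x) := by
    rw [← ContinuousLinearMap.comp_apply, ← S.op_add, add_comm, S.op_add,
      ContinuousLinearMap.comp_apply]
  simp only [Function.comp_apply, map_smul, map_sub, h1]

variable [CompleteSpace X]

theorem dense_generator_domain : Dense (S.generator.domain : Set X) := by
  let _ : NormedSpace ℝ X := NormedSpace.restrictScalars ℝ 𝕜 X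
  have : IsScalarTower ℝ 𝕜 X := ⟨fun r c x => by
    change (r • c) • x = ((algebraMap ℝ 𝕜 r) : 𝕜) • (c • x)
    rw [Algebra.smul_def, mul_smul]⟩
  have hsm : ∀ (r : ℝ) (x : X), ((r : 𝕜)) • x = r • x := fun r x => rfl
  intro x
  set g : ℝ → X := fun s => S.op s.toNNReal x with hg
  have hgc : Continuous g := (S.continuous_orbit x).comp continuous_real_toNNReal
  have hgi : ∀ a b : ℝ, IntervalIntegrable g volume a b := fun a b => hgc.intervalIntegrable a b
  have hg0 : g 0 = x := by simp [hg, S.op_zero]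
  set G : ℝ → X := fun r => ∫ s in (0 : ℝ)..r, g s with hG
  have hG0 : G 0 = 0 := by simp [hG]
  have hGd : ∀ r, HasDerivAt G (g r) r := fun r =>
    intervalIntegral.integral_hasDerivAt_right (hgi 0 r)
      (hgc.stronglyMeasurableAtFilter _ _) hgc.continuousAt
  have hto : Tendsto (fun h : ℝ≥0 => (h : ℝ)) (𝓝[>] 0) (𝓝[≠] 0) := by
    refine tendsto_nhdsWithin_iff.2 ⟨?_, ?_⟩
    · exact (NNReal.continuous_coe.tendsto' 0 0 NNReal.coe_zero).mono_left nhdsWithin_le_nhds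
    · filter_upwards [self_mem_nhdsWithin] with h hh
      simpa using (ne_of_gt hh)
  have hslope : ∀ r, Tendsto (fun h : ℝ≥0 => (h : ℝ)⁻¹ • (G (r + h) - G r)) (𝓝[>] 0) (𝓝 (g r)) :=
    fun r => ((hasDerivAt_iff_tendsto_slope_zero.1 (hGd r)).comp hto)
  have hmem : ∀ r : ℝ, 0 ≤ r → G r ∈ S.generator.domain := by
    intro r hr
    refine ⟨g r - g 0, ?_⟩
    refine ((hslope r).sub (hslope 0)).congr fun h => ?_
    have h1 : S.op h (G r) = G (r + h) - G h := by
      have e1 : S.op h (G r) = ∫ s in (0 : ℝ)..r, S.op h (g s) :=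
        (((S.op h).restrictScalars ℝ).intervalIntegral_comp_comm (hgi 0 r)).symm
      have e2 : (∫ s in (0 : ℝ)..r, S.op h (g s)) = ∫ s in (0 : ℝ)..r, g (s + h) := by
        refine intervalIntegral.integral_congr fun s hs => ?_
        rw [Set.uIcc_of_le hr] at hs
        simp only [hg]
        rw [Real.toNNReal_add (r := s) (p := (h : ℝ)) hs.1 h.2, Real.toNNReal_coe, add_comm, S.op_add]
        rfl
      rw [e1, e2, intervalIntegral.integral_comp_add_right, zero_add]
      exact (intervalIntegral.integral_interval_sub_left (hgi _ _) (hgi _ _)).symm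
    rw [h1, ← RCLike.ofReal_inv, hsm]
    rw [← smul_sub, hG0, zero_add]
    congr 1
    abel
  have hlim : Tendsto (fun h : ℝ≥0 => (h : ℝ)⁻¹ • (G h)) (𝓝[>] 0) (𝓝 x) := by
    have := hslope 0
    simpa only [zero_add, hG0, sub_zero, hg0] using this
  refine mem_closure_of_tendsto hlim (Eventually.of_forall fun h => ?_)
  rw [← hsm]
  exact S.generator.domain.smul_mem _ (hmem h h.2)

/-- `D(A*)` with the graph norm `(‖φ‖² + ‖A*φ‖²)^(1/2)`, realized as the graph of the adjoint
`A*` of the generator: its elements are the pairs `(φ, A*φ)`. -/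
def adjointDomain : Submodule 𝕜 (WithLp 2 (X × X)) :=
  (LinearPMap.adjoint S.generator).graph.comap (WithLp.linearEquiv 2 𝕜 (X × X)).toLinearMap

theorem mem_adjointDomain_iff (p : WithLp 2 (X × X)) :
    p ∈ S.adjointDomain ↔
      ∀ x : S.generator.domain, inner 𝕜 p.fst (S.generator x) = inner 𝕜 p.snd (x : X) := by
  have key : p ∈ S.adjointDomain ↔ p.ofLp ∈ S.generator.graph.adjoint := by
    rw [← LinearPMap.adjoint_graph_eq_graph_adjoint S.dense_generator_domain]
    rfl
  rw [key, Submodule.mem_adjoint_iff]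
  constructor
  · intro h x
    have := h x (S.generator x) (S.generator.mem_graph x)
    rw [sub_eq_zero] at this
    have h2 := congrArg (starRingEnd 𝕜) this
    simp only [inner_conj_symm] at h2
    exact h2
  · intro h a b hab
    obtain ⟨y, hy, rfl⟩ := (LinearPMap.mem_graph_iff _).1 hab
    have h2 := congrArg (starRingEnd 𝕜) (h y)
    simp only [inner_conj_symm] at h2
    rw [sub_eq_zero]
    have hy' : (y : X) = a := hy
    rw [← hy']
    exact h2

/-- The restriction of the adjoint operator `S(t)*` to `D(A*)`, which it leaves invariant,
as a bounded operator for the graph norm: `(φ, A*φ) ↦ (S(t)*φ, S(t)*A*φ)`. -/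
def adjointOp (t : ℝ≥0) : S.adjointDomain →L[𝕜] S.adjointDomain :=
  ((((WithLp.prodContinuousLinearEquiv 2 𝕜 X X).symm : X × X →L[𝕜] WithLp 2 (X × X)).comp
    (((S.op t).adjoint.prodMap (S.op t).adjoint).comp
      ((WithLp.prodContinuousLinearEquiv 2 𝕜 X X) : WithLp 2 (X × X) →L[𝕜] X × X))).comp
        S.adjointDomain.subtypeL).codRestrict S.adjointDomain fun p => by
    rw [mem_adjointDomain_iff]
    intro x
    obtain ⟨hx, hAx⟩ := S.generator_op t x
    have := (S.mem_adjointDomain_iff p).1 p.2 ⟨S.op t x, hx⟩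
    rw [hAx] at this
    change inner 𝕜 ((S.op t).adjoint (p : WithLp 2 (X × X)).fst) (S.generator x) =
      inner 𝕜 ((S.op t).adjoint (p : WithLp 2 (X × X)).snd) (x : X)
    rw [ContinuousLinearMap.adjoint_inner_left, ContinuousLinearMap.adjoint_inner_left]
    exact this

/-- `X₋₁`: the (anti-)dual of `D(A*)` with respect to the pivot space `X`. -/
abbrev Xneg : Type _ := S.adjointDomain →L⋆[𝕜] 𝕜

/-- The embedding `X → X₋₁`, `x ↦ (φ ↦ ⟨x, φ⟩)` (Mathlib's inner product is conjugate linear in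
its first argument). -/
def embed (x : X) : S.Xneg :=
  ((innerSL 𝕜 : X →L⋆[𝕜] X →L[𝕜] 𝕜).flip x).comp
    ((WithLp.fstL 2 𝕜 X X).comp S.adjointDomain.subtypeL)

/-- The extension of `S(t)` to `X₋₁`: `⟨S(t)ξ, φ⟩ = ⟨ξ, S(t)*φ⟩` for `φ ∈ D(A*)`. -/
def opNeg (t : ℝ≥0) (ξ : S.Xneg) : S.Xneg := ξ.comp (S.adjointOp t)

variable {U : Type v} [NormedAddCommGroup U] [InnerProductSpace 𝕜 U]

/-- The input map `Ψ_τ f = ∫₀^τ S(τ - t) B f(t) dt`, a Bochner integral in `X₋₁`. -/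
def inputMap (B : U →L[𝕜] S.Xneg) (τ : ℝ≥0) (f : ℝ → U) : S.Xneg :=
  ∫ t in (0 : ℝ)..τ, S.opNeg ((τ : ℝ) - t).toNNReal (B (f t))

/-- `B` is an admissible control operator: for some `τ > 0`, `Ψ_τ f ∈ X` for all
`f ∈ L²(0, τ; U)`. -/
def IsAdmissibleControl (B : U →L[𝕜] S.Xneg) : Prop :=
  ∃ τ : ℝ≥0, 0 < τ ∧ ∀ f : ℝ → U, MemLp f 2 (volume.restrict (Set.Ioo (0 : ℝ) τ)) →
    S.inputMap B τ f ∈ Set.range S.embed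

/-- The state `z(t; f, 0, z₀) = S(t) z₀ + ∫₀^t S(t - s) B f(s) ds` of `z' = A z + B f`,
`z(0) = z₀`, at time `t`, as an element of `X₋₁ ⊇ X`. -/
def state (B : U →L[𝕜] S.Xneg) (z₀ : X) (f : ℝ → U) (t : ℝ≥0) : S.Xneg :=
  S.embed (S.op t z₀) + S.inputMap B t f

/-- The admissible controls: measurable `f : (0, ∞) → U` with `‖f(t)‖ ≤ M` for a.e. `t > 0`. -/
def controls (U : Type v) [NormedAddCommGroup U] (M : ℝ) : Set (ℝ → U) :=
  {f | AEStronglyMeasurable f (volume.restrict (Set.Ioi (0 : ℝ))) ∧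
    ∀ᵐ t ∂(volume.restrict (Set.Ioi (0 : ℝ))), ‖f t‖ ≤ M}

/-- The times `t > 0` at which the target `z₁` can be reached from `z₀` with norm bound `M`. -/
def reachTimes (B : U →L[𝕜] S.Xneg) (z₀ z₁ : X) (M : ℝ) : Set ℝ≥0 :=
  {t | 0 < t ∧ ∃ f ∈ controls U M, S.state B z₀ f t = S.embed z₁}

/-- `f` is an optimal control and `T = T(M)` the optimal time: `T` is the infimum of the times
at which `z₁` can be reached (so there are such times), and `f` is a control with
`z(T; f, 0, z₀) = z₁`. -/
def IsOptimal (B : U →L[𝕜] S.Xneg) (z₀ z₁ : X) (M : ℝ) (T : ℝ≥0) (f : ℝ → U) : Prop :=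
  IsGLB (S.reachTimes B z₀ z₁ M) T ∧ f ∈ controls U M ∧ S.state B z₀ f T = S.embed z₁

/-- The bang-bang property of the time optimal control problem: every optimal control `f`
satisfies `‖f(t)‖ = M` for a.e. `t ∈ (0, T(M))`. -/
def BangBang (B : U →L[𝕜] S.Xneg) (z₀ z₁ : X) (M : ℝ) : Prop :=
  ∀ (T : ℝ≥0) (f : ℝ → U), S.IsOptimal B z₀ z₁ M T f →
    ∀ᵐ t ∂(volume.restrict (Set.Ioo (0 : ℝ) T)), ‖f t‖ = M

variable [CompleteSpace U]

/-- The adjoint `B* : D(A*) → U` of `B : U → X₋₁`: `⟨u, B*φ⟩_U = ⟨B u, φ⟩` for `u ∈ U`,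
`φ ∈ D(A*)`. -/
def adjointControl (B : U →L[𝕜] S.Xneg) (φ : S.adjointDomain) : U :=
  (InnerProductSpace.toDual 𝕜 U).symm (B.flip φ)

theorem inner_adjointControl (B : U →L[𝕜] S.Xneg) (φ : S.adjointDomain) (u : U) :
    inner 𝕜 (S.adjointControl B φ) u = B u φ := by
  simp [adjointControl]

/-- The observability inequality from time intervals for `(A*, B*)`:
`‖S(L)*φ‖² ≤ exp(d / L^k) ∫₀^L ‖B* S(t)* φ‖² dt` for all `φ ∈ D(A*)` and `L ∈ (0, 1]`. -/
def IsObservable (B : U →L[𝕜] S.Xneg) (d k : ℝ) : Prop :=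
  ∀ φ : S.adjointDomain, ∀ L : ℝ≥0, 0 < L → L ≤ 1 →
    ‖(S.op L).adjoint (φ : WithLp 2 (X × X)).fst‖ ^ 2 ≤
      Real.exp (d / (L : ℝ) ^ k) *
        ∫ t in (0 : ℝ)..L, ‖S.adjointControl B (S.adjointOp t.toNNReal φ)‖ ^ 2

end C0Semigroup

end

/-! Suppose a control `f` steers z₀ to z₁ in time T but is not of norm M almost everywhere. Then ‖f‖
≤ M - ε on a set E ⊆ (ε, T) of positive measure. Discard the first δ < ε of `f` and run the rest
from z₀. At time T - δ the state misses z₁ by -S(T - ε)y, where y → 0 as δ → 0, by continuity of the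
orbit of z₀ and by admissibility. If a control supported in E and of sup norm at most C‖y‖ ≤ ε
produces S(T - ε)y, the corrected control still obeys the bound M and reaches z₁ before T
(`IsAnalytic.exists_earlier`). So T was not the infimum.

By Hahn-Banach and Riesz such a control exists (`IsAnalytic.exists_control`) once the adjoint system
is observable from E in the L¹ norm: ‖S(T - ε)*φ‖ ≤ C ∫_E ‖B*S(T - s)*φ‖ ds. It is L¹ rather than L²
that yields a sup norm bound on the control.

This observability (`IsAnalytic.exists_observability_of_measure`) combines the assumed inequality on
intervals with analyticity. Near a time s, real parts of scalar outputs extend holomorphically to a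
disc of radius comparable to s, with bound (C/s)‖ψ‖ in the norm of X. Taylor polynomials of degree
below n approximate them with an error geometric in n, and a Remez inequality
(`abs_eval_le_of_measure`) controls such polynomials by 100^n times their size on a quarter of the
interval. Smallness on E thus spreads to an interval, up to a term (C/s) 10^(-4n) times the norm at
an earlier time. Take times decreasing geometrically to a density point of E. Degrees growing like
2^m beat the cost exp(D/L^k), and the weighted estimates telescope with a vanishing remainder
(`exists_telescoping_weights`). -/

/-- Hahn-Banach extension along a linear map. -/
theorem exists_dual_of_norm_le {𝕜 : Type*} [RCLike 𝕜] {V N : Type*} [AddCommGroup V] [Module 𝕜 V]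
    [SeminormedAddCommGroup N] [NormedSpace 𝕜 N] (Φ : V →ₗ[𝕜] N) (l : V →ₗ[𝕜] 𝕜) {C : ℝ}
    (hC : 0 ≤ C) (h : ∀ v, ‖l v‖ ≤ C * ‖Φ v‖) :
    ∃ g : N →L[𝕜] 𝕜, ‖g‖ ≤ C ∧ ∀ v, g (Φ v) = l v := by
  have hl : ∀ v w, Φ v = Φ w → l v = l w := fun v w hvw => by
    have := h (v - w)
    rw [map_sub, map_sub, hvw, sub_self, norm_zero, mul_zero] at this
    exact sub_eq_zero.1 (norm_le_zero_iff.1 this)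
  let s : LinearMap.range Φ → V := fun y => Classical.choose y.2
  have hs : ∀ y, Φ (s y) = y := fun y => Classical.choose_spec y.2
  let m : LinearMap.range Φ →ₗ[𝕜] 𝕜 :=
    { toFun := fun y => l (s y)
      map_add' := fun y z => by rw [← map_add]; exact hl _ _ (by simp [hs])
      map_smul' := fun a y => by
        rw [RingHom.id_apply, ← map_smul]; exact hl _ _ (by simp [hs]) }
  have hm : ∀ y, ‖m y‖ ≤ C * ‖y‖ := fun y => (h (s y)).trans_eq (by rw [hs]; rfl)
  obtain ⟨g, hg, hgn⟩ := exists_extension_norm_eq (LinearMap.range Φ) (m.mkContinuous C hm)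
  refine ⟨g, hgn.trans_le (m.mkContinuous_norm_le hC hm), fun v => ?_⟩
  rw [show Φ v = ((⟨Φ v, v, rfl⟩ : LinearMap.range Φ) : N) from rfl, hg]
  exact hl _ _ (hs _)

/-! ### A Remez type inequality for polynomials -/

/-- Greedy choice from the left: a point of `A` close to its infimum, together with the stretch of
length σ to its right, uses up barely more than σ of measure, and the induction continues in the
rest. -/
theorem exists_separated_points {σ : ℝ} (hσ : 0 < σ) (n : ℕ) : ∀ A : Set ℝ, BddBelow A →
    ENNReal.ofReal (n * σ) < volume A → ∃ x : ℕ → ℝ, (∀ j < n, x j ∈ A) ∧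
      ∀ i j, i < j → j < n → ((j : ℝ) - i) * σ ≤ x j - x i := by
  induction n with
  | zero => exact fun A _ _ => ⟨fun _ => 0, by simp, by simp⟩
  | succ n ih =>
    intro A hA hv
    obtain ⟨r, hr0, hr1, hr2⟩ := ENNReal.lt_iff_exists_real_btwn.1 hv
    have hne : A.Nonempty := nonempty_of_measure_ne_zero (ne_bot_of_gt hv)
    have hrr : ((n + 1 : ℕ) : ℝ) * σ < r := (ENNReal.ofReal_lt_ofReal_iff_of_nonneg (by positivity)).1 hr1
    push_cast at hrr
    -- The infimum need not be attained; the slack between the measure and (n + 1)σ pays for the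
    -- distance from it to `x₀`.
    obtain ⟨x₀, hx₀, hx₀m⟩ := exists_lt_of_csInf_lt hne
      (show sInf A < sInf A + (r - (n + 1) * σ) by linarith)
    have hm : sInf A ≤ x₀ := csInf_le hA hx₀
    have hsub : A ⊆ (A ∩ Set.Ici (x₀ + σ)) ∪ Set.Ico (sInf A) (x₀ + σ) := fun y hy => by
      rcases le_or_gt (x₀ + σ) y with h | h
      · exact Or.inl ⟨hy, h⟩
      · exact Or.inr ⟨csInf_le hA hy, h⟩
    have hvol : ENNReal.ofReal (n * σ) < volume (A ∩ Set.Ici (x₀ + σ)) := by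
      by_contra! hcon
      have h1 : volume A ≤ ENNReal.ofReal (n * σ) + ENNReal.ofReal (x₀ + σ - sInf A) := by
        refine (measure_mono hsub).trans ((measure_union_le _ _).trans ?_)
        rw [Real.volume_Ico]
        gcongr
      rw [← ENNReal.ofReal_add (by positivity) (by linarith)] at h1
      exact absurd (h1.trans (ENNReal.ofReal_le_ofReal (by linarith))) (not_le.2 hr2)
    obtain ⟨x, hx, hsep⟩ := ih _ (hA.mono Set.inter_subset_left) hvol
    refine ⟨fun j => Nat.casesOn j x₀ x, ?_, ?_⟩
    · rintro (_ | j) hj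
      · exact hx₀
      · exact (hx j (by omega)).1
    · rintro (_ | i) (_ | j) hij hj
      · omega
      · have h1 : x₀ + σ ≤ x 0 := (hx 0 (by omega)).2
        have h2 : (j : ℝ) * σ ≤ x j - x 0 := by
          rcases Nat.eq_zero_or_pos j with rfl | hj0
          · simp
          · simpa using hsep 0 j hj0 (by omega)
        push_cast
        change _ ≤ x j - x₀
        linarith
      · omega
      · have := hsep i j (by omega) (by omega)
        push_cast
        change _ ≤ x j - x i
        linarith

/-- The Lagrange denominator for equally spaced nodes, with which σ-separated nodes are compared. -/
theorem prod_erase_abs_sub (i m : ℕ) :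
    ∏ j ∈ (Finset.range (i + 1 + m)).erase i, |(i : ℝ) - j| = (i.factorial * m.factorial : ℕ) := by
  induction m with
  | zero =>
    rw [add_zero, Finset.range_add_one, Finset.erase_insert (by simp), ← Finset.prod_range_reflect]
    rw [← Finset.prod_range_add_one_eq_factorial]
    push_cast
    rw [Nat.factorial_zero, Nat.cast_one, mul_one]
    refine Finset.prod_congr rfl fun j hj => ?_
    have hj' : j + 1 ≤ i := Finset.mem_range.1 hj
    rw [show i - 1 - j = i - (j + 1) by omega, Nat.cast_sub hj']
    push_cast
    rw [abs_of_nonneg] <;> ring_nf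
    positivity
  | succ m ih =>
    rw [← add_assoc, Finset.range_add_one, Finset.erase_insert_of_ne (by omega), Finset.prod_insert (by simp), ih]
    rw [Nat.factorial_succ, abs_sub_comm, abs_of_nonneg (by push_cast; linarith)]
    push_cast
    ring

theorem factorial_le_two_pow_mul (i m : ℕ) :
    ((i + m).factorial : ℝ) ≤ 2 ^ (i + m) * (i.factorial * m.factorial : ℕ) := by
  have h1 := Nat.add_choose_mul_factorial_mul_factorial i m
  have h2 : (i + m).choose m ≤ 2 ^ (i + m) := Nat.choose_le_two_pow _ _
  rw [← h1, mul_assoc]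
  push_cast
  gcongr
  exact_mod_cast h2

/-- A Remez type inequality: a polynomial of degree less than `n` is controlled on an interval by
its values on a subset of a quarter of the length. -/
theorem abs_eval_le_of_measure {n : ℕ} {P : Polynomial ℝ} (hP : P.degree < n) {a l ε : ℝ}
    (hl : 0 < l) (hε : 0 ≤ ε) {A : Set ℝ} (hA : A ⊆ Set.Icc a (a + l))
    (hv : ENNReal.ofReal (l / 4) ≤ volume A) (hb : ∀ x ∈ A, |P.eval x| ≤ ε) {y : ℝ}
    (hy : y ∈ Set.Icc a (a + l)) : |P.eval y| ≤ 100 ^ n * ε := by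
  rcases Nat.eq_zero_or_pos n with rfl | hn
  · have : P = 0 := by
      rw [← Polynomial.degree_eq_bot]
      simpa using hP
    simpa [this] using hε
  have hn' : (0 : ℝ) < n := by exact_mod_cast hn
  -- The `n` nodes need only nσ = l/8 of measure, strictly less than the available l/4.
  obtain ⟨σ, hσ⟩ : ∃ σ : ℝ, σ = l / (8 * n) := ⟨_, rfl⟩
  have hσ0 : 0 < σ := by rw [hσ]; positivity
  obtain ⟨x, hxA, hsep⟩ := exists_separated_points hσ0 n A ⟨a, fun z hz => (hA hz).1⟩
    (lt_of_lt_of_le ((ENNReal.ofReal_lt_ofReal_iff (by positivity)).2 (by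
      rw [hσ]; field_simp; norm_num)) hv)
  have habs : ∀ i < n, ∀ j < n, |(i : ℝ) - j| * σ ≤ |x i - x j| := by
    intro i hi j hj
    rcases lt_trichotomy i j with h | rfl | h
    · have h' : (i : ℝ) < j := by exact_mod_cast h
      rw [abs_sub_comm, abs_sub_comm (x i), abs_of_pos (by linarith)]
      exact (hsep i j h hj).trans (le_abs_self _)
    · simp
    · have h' : (j : ℝ) < i := by exact_mod_cast h
      rw [abs_of_pos (by linarith)]
      exact (hsep j i h hi).trans (le_abs_self _)
  have hinj : Set.InjOn x (Finset.range n : Finset ℕ) := by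
    intro i hi j hj hij
    have := habs i (Finset.mem_range.1 hi) j (Finset.mem_range.1 hj)
    rw [hij, sub_self, abs_zero] at this
    have h0 : |(i : ℝ) - j| = 0 := le_antisymm (by nlinarith [abs_nonneg ((i : ℝ) - j)]) (abs_nonneg _)
    exact_mod_cast sub_eq_zero.1 (abs_eq_zero.1 h0)
  have hterm : ∀ i ∈ Finset.range n,
      |(Polynomial.C (P.eval (x i)) * Lagrange.basis (Finset.range n) x i).eval y| ≤
        50 ^ n * ε := by
    intro i hi
    have hi' := Finset.mem_range.1 hi
    obtain ⟨m, rfl⟩ : ∃ m, n = i + 1 + m := ⟨n - (i + 1), by omega⟩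
    set n := i + 1 + m with hnn
    rw [Polynomial.eval_mul, Polynomial.eval_C, abs_mul, Lagrange.basis, Polynomial.eval_prod,
      Finset.abs_prod]
    have h1 : ∏ j ∈ (Finset.range n).erase i, |(Lagrange.basisDivisor (x i) (x j)).eval y| ≤
        ∏ j ∈ (Finset.range n).erase i, (8 * n) * |(i : ℝ) - j|⁻¹ := by
      refine Finset.prod_le_prod (fun _ _ => abs_nonneg _) fun j hj => ?_
      obtain ⟨hji, hjn⟩ := Finset.mem_erase.1 hj
      have hjn := Finset.mem_range.1 hjn
      have hij0 : 0 < |(i : ℝ) - j| := abs_pos.2 (sub_ne_zero.2 (by exact_mod_cast hji.symm))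
      have h2 := habs i hi' j hjn
      have h3 : |y - x j| ≤ l := by
        have := hA (hxA j hjn)
        rw [abs_le]
        constructor <;> linarith [this.1, this.2, hy.1, hy.2]
      rw [Lagrange.basisDivisor, Polynomial.eval_mul, Polynomial.eval_C, Polynomial.eval_sub,
        Polynomial.eval_X, Polynomial.eval_C, abs_mul, abs_inv]
      calc |x i - x j|⁻¹ * |y - x j| ≤ (|(i : ℝ) - j| * σ)⁻¹ * l := by gcongr
        _ = _ := by rw [hσ]; field_simp
    have h4 : ∏ j ∈ (Finset.range n).erase i, (8 * n : ℝ) * |(i : ℝ) - j|⁻¹ =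
        (8 * n) ^ (n - 1) * ((i.factorial * m.factorial : ℕ) : ℝ)⁻¹ := by
      rw [Finset.prod_mul_distrib, Finset.prod_const, Finset.prod_inv_distrib, hnn,
        prod_erase_abs_sub, Finset.card_erase_of_mem (by simpa using hi'), Finset.card_range]
    -- From n^n/n! ≤ e^n comes n^(n-1) ≤ 3^n (n-1)!, and (n-1)! ≤ 2^(n-1) i! m!. The base is then
    -- 8·2·3 = 48. Summing n ≤ 2^n terms later turns 50 into 100.
    have h5 : ((8 * n : ℝ)) ^ (n - 1) * ((i.factorial * m.factorial : ℕ) : ℝ)⁻¹ ≤ 50 ^ n := by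
      have h6 := factorial_le_two_pow_mul i m
      have e1 : n - 1 = i + m := by omega
      have h7 := Real.pow_div_factorial_le_exp n hn'.le n
      have h8 : Real.exp n ≤ 3 ^ n := by
        rw [show (n : ℝ) = n * 1 by ring, Real.exp_nat_mul]
        gcongr
        exact (Real.exp_one_lt_d9.trans (by norm_num)).le
      have e2 : n.factorial = n * (i + m).factorial := by
        rw [show n = (i + m) + 1 by omega, Nat.factorial_succ]
      have e3 : (n : ℝ) ^ n = n ^ (i + m) * n := by
        rw [← pow_succ]; congr 1; omega
      have hf : (0 : ℝ) < (i + m).factorial := by positivity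
      have hf2 : (0 : ℝ) < (i.factorial * m.factorial : ℕ) := by positivity
      have h9 : (n : ℝ) ^ (i + m) ≤ 3 ^ n * (i + m).factorial := by
        have := h7.trans h8
        rw [e2, div_le_iff₀ (by positivity)] at this
        push_cast at this
        nlinarith
      rw [e1, ← div_eq_mul_inv, div_le_iff₀ hf2, mul_pow]
      calc (8 : ℝ) ^ (i + m) * n ^ (i + m) ≤ 8 ^ (i + m) * (3 ^ n * (2 ^ (i + m) * (i.factorial * m.factorial : ℕ))) := by
            gcongr
            exact h9.trans (by gcongr)
        _ = (16 ^ (i + m) * 3 ^ n) * (i.factorial * m.factorial : ℕ) := by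
            rw [show (16 : ℝ) = 8 * 2 by norm_num, mul_pow]; ring
        _ ≤ (16 ^ n * 3 ^ n) * (i.factorial * m.factorial : ℕ) := by
            gcongr
            · norm_num
            · omega
        _ ≤ _ := by
            rw [← mul_pow]; gcongr; norm_num
    have h6 : |P.eval (x i)| ≤ ε := hb _ (hxA i hi')
    calc _ ≤ ε * 50 ^ n := by
          refine mul_le_mul h6 (h1.trans (h4.le.trans h5)) (Finset.prod_nonneg fun _ _ => abs_nonneg _) hε
      _ = _ := mul_comm _ _
  have heq := Lagrange.eq_interpolate (s := Finset.range n) (v := x) (f := P) hinj (by simpa using hP)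
  rw [heq, Lagrange.interpolate_apply, Polynomial.eval_finsetSum]
  refine (Finset.abs_sum_le_sum_abs _ _).trans ((Finset.sum_le_card_nsmul _ _ _ hterm).trans ?_)
  rw [Finset.card_range, nsmul_eq_mul, show (100 : ℝ) = 2 * 50 by norm_num, mul_pow, mul_assoc]
  have : (n : ℝ) ≤ 2 ^ n := by exact_mod_cast Nat.lt_two_pow_self.le
  gcongr

/-! ### Propagation of smallness for holomorphic functions -/

/-- Cauchy's estimate on the circle of radius `R` bounds the Taylor coefficients by M/R^j, and the
tail is geometric. As x - c is real, taking real parts of the coefficients gives a real polynomial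
for the real part. -/
theorem exists_polynomial_approx {H : ℂ → ℂ} {c R M : ℝ} (hR : 0 < R)
    (hd : DifferentiableOn ℂ H (Metric.ball (c : ℂ) (2 * R)))
    (hM : ∀ z ∈ Metric.ball (c : ℂ) (2 * R), ‖H z‖ ≤ M) (n : ℕ) :
    ∃ P : Polynomial ℝ, P.degree < n ∧ ∀ q : ℝ, q ≤ 1 / 2 → ∀ x : ℝ, |x - c| ≤ q * R →
      |(H x).re - P.eval x| ≤ 2 * M * q ^ n := by
  have hM0 : 0 ≤ M := (norm_nonneg _).trans (hM c (by simpa using hR))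
  set a : ℕ → ℂ := fun j => (j.factorial : ℂ)⁻¹ * iteratedDeriv j H c with ha
  have hab : ∀ j, ‖a j‖ ≤ M / R ^ j := by
    intro j
    have hsub : Metric.closedBall (c : ℂ) R ⊆ Metric.ball (c : ℂ) (2 * R) :=
      Metric.closedBall_subset_ball (by linarith)
    have := Complex.norm_iteratedDeriv_le_of_forall_mem_sphere_norm_le (f := H) (C := M) j hR
      (DifferentiableOn.diffContOnCl (by
        rw [closure_ball _ hR.ne']; exact hd.mono hsub))
      (fun z hz => hM z (hsub (Metric.sphere_subset_closedBall hz)))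
    rw [ha]
    simp only [norm_mul, norm_inv, RCLike.norm_natCast]
    rw [inv_mul_le_iff₀ (by positivity)]
    rwa [mul_div_assoc'] 
  refine ⟨∑ j ∈ Finset.range n, Polynomial.C (a j).re * (Polynomial.X - Polynomial.C c) ^ j, ?_, ?_⟩
  · refine (Polynomial.degree_sum_le _ _).trans_lt ?_
    refine (Finset.sup_lt_iff (WithBot.bot_lt_coe n)).2 ?_
    intro j hj
    rw [← Polynomial.smul_eq_C_mul]
    refine lt_of_le_of_lt (Polynomial.degree_smul_le _ _) ?_
    rw [Polynomial.degree_pow, Polynomial.degree_X_sub_C, nsmul_eq_mul, mul_one]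
    exact Nat.cast_lt.2 (Finset.mem_range.1 hj)
  · intro q hq x hx
    have hq0 : 0 ≤ q := by
      have := (abs_nonneg _).trans hx
      exact nonneg_of_mul_nonneg_left this hR
    have hxb : (x : ℂ) ∈ Metric.ball (c : ℂ) (2 * R) := by
      rw [Metric.mem_ball, Complex.dist_eq, ← Complex.ofReal_sub, Complex.norm_real, Real.norm_eq_abs]
      nlinarith
    have hs := Complex.hasSum_taylorSeries_on_ball hd hxb
    have hs' : HasSum (fun j => a j * ((x : ℂ) - c) ^ j) (H x) := by
      refine hs.congr_fun ?_ 
      intro j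
      simp only [ha, smul_eq_mul]
      ring
    have ht := (hasSum_nat_add_iff' n).2 hs'
    have hg : HasSum (fun j : ℕ => M * q ^ n * q ^ j) (M * q ^ n * (1 - q)⁻¹) :=
      (hasSum_geometric_of_lt_one hq0 (by linarith)).mul_left _
    have hle : ‖H x - ∑ j ∈ Finset.range n, a j * ((x : ℂ) - c) ^ j‖ ≤ M * q ^ n * (1 - q)⁻¹ := by
      refine ht.norm_le_of_bounded hg fun j => ?_
      rw [norm_mul, norm_pow, ← Complex.ofReal_sub, Complex.norm_real, Real.norm_eq_abs, mul_assoc,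
        ← pow_add]
      calc ‖a (j + n)‖ * |x - c| ^ (j + n) ≤ M / R ^ (j + n) * (q * R) ^ (j + n) := by
            gcongr; exact hab _
        _ = M * q ^ (n + j) := by rw [mul_pow, add_comm]; field_simp
    have hre : (H x).re - Polynomial.eval x (∑ j ∈ Finset.range n,
        Polynomial.C (a j).re * (Polynomial.X - Polynomial.C c) ^ j) =
        (H x - ∑ j ∈ Finset.range n, a j * ((x : ℂ) - c) ^ j).re := by
      rw [Complex.sub_re, Complex.re_sum, Polynomial.eval_finsetSum]
      congr 1
      refine Finset.sum_congr rfl fun j _ => ?_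
      rw [← Complex.ofReal_sub, ← Complex.ofReal_pow, Complex.re_mul_ofReal]
      simp
    rw [hre]
    refine (Complex.abs_re_le_norm _).trans (hle.trans ?_)
    have : (1 - q)⁻¹ ≤ 2 := by
      rw [inv_le_comm₀ (by linarith) (by norm_num)]; linarith
    calc _ ≤ M * q ^ n * 2 := by gcongr
      _ = _ := by ring

/-- Propagation of smallness from a set of positive measure, for the real part of a bounded
holomorphic function. -/
theorem abs_re_le_of_measure {H : ℂ → ℂ} {c R M : ℝ} (hR : 0 < R)
    (hd : DifferentiableOn ℂ H (Metric.ball (c : ℂ) (2 * R)))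
    (hM : ∀ z ∈ Metric.ball (c : ℂ) (2 * R), ‖H z‖ ≤ M) (n : ℕ) {q ε : ℝ} (hq : 0 < q)
    (hq2 : q ≤ 1 / 2) (hε : 0 ≤ ε) {A : Set ℝ} (hA : A ⊆ Set.Icc (c - q * R) c)
    (hv : ENNReal.ofReal (q * R / 4) ≤ volume A) (hb : ∀ x ∈ A, |(H x).re| ≤ ε) {y : ℝ}
    (hy : y ∈ Set.Icc (c - q * R) c) : |(H y).re| ≤ 100 ^ n * ε + 4 * M * (100 * q) ^ n := by
  have hM0 : 0 ≤ M := (norm_nonneg _).trans (hM c (by simpa using hR))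
  obtain ⟨P, hP, happ⟩ := exists_polynomial_approx hR hd hM n
  have hx : ∀ x ∈ Set.Icc (c - q * R) c, |(H x).re - P.eval x| ≤ 2 * M * q ^ n := fun x hx =>
    happ q hq2 x (by rw [abs_le]; constructor <;> nlinarith [hx.1, hx.2])
  have h1 := abs_eval_le_of_measure (P := P) hP (a := c - q * R) (l := q * R)
    (ε := ε + 2 * M * q ^ n) (by positivity) (by positivity) (by simpa using hA) hv
    (fun x hxA => by
      have h1 := abs_le.1 (hx x (hA hxA))
      have h2 := abs_le.1 (hb x hxA)
      rw [abs_le]; constructor <;> linarith) (y := y) (by simpa using hy)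
  have h2 := abs_le.1 (hx y hy)
  have h3 := abs_le.1 h1
  have h4 : 2 * M * q ^ n ≤ 2 * M * (100 * q) ^ n := by
    gcongr
    linarith
  have h5 : (100 : ℝ) ^ n * (ε + 2 * M * q ^ n) = 100 ^ n * ε + 2 * M * (100 * q) ^ n := by
    rw [mul_pow]; ring
  rw [abs_le]; constructor <;> linarith

/-! ### Sectors and holomorphic extension of the outputs -/

/-- The argument is invariant under positive scaling, so one disc around 1 serves for every `s`. -/
theorem exists_ball_subset_openSector {θ : ℝ} (hθ : 0 < θ) :
    ∃ r : ℝ, 0 < r ∧ r < 1 ∧ ∀ s : ℝ, 0 < s → Metric.ball (s : ℂ) (r * s) ⊆ openSector θ := by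
  have h1 : ContinuousAt Complex.arg 1 := Complex.continuousAt_arg (by simp [Complex.slitPlane])
  have h2 : ∀ᶠ z in 𝓝 (1 : ℂ), |z.arg| < θ := by
    have : Tendsto (fun z : ℂ => |z.arg|) (𝓝 1) (𝓝 0) := by
      simpa using (h1.tendsto.abs)
    exact this.eventually_lt_const hθ
  obtain ⟨r, hr, hball⟩ := Metric.eventually_nhds_iff_ball.1 h2
  refine ⟨min r (1 / 2), by positivity, (min_le_right _ _).trans_lt (by norm_num), fun s hs z hz => ?_⟩
  have hs' : (s : ℂ) ≠ 0 := by exact_mod_cast hs.ne'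
  have hz' : z = (s : ℂ) * (z / s) := by field_simp
  have hd : dist (z / s) 1 < min r (1 / 2) := by
    rw [Metric.mem_ball, dist_eq_norm] at hz
    rw [dist_eq_norm, show z / s - 1 = (z - s) / s by field_simp, norm_div, Complex.norm_real,
      Real.norm_of_nonneg hs.le, div_lt_iff₀ hs]
    exact hz
  constructor
  · rintro rfl
    rw [zero_div, dist_eq_norm, zero_sub, norm_neg, norm_one] at hd
    have := min_le_right r (1 / 2)
    linarith
  · rw [hz', Complex.arg_real_mul _ hs]
    exact hball _ (lt_of_lt_of_le hd (min_le_left _ _))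

theorem ofReal_mem_openSector {θ t : ℝ} (hθ : 0 < θ) (ht : 0 < t) : (t : ℂ) ∈ openSector θ :=
  ⟨by exact_mod_cast ht.ne', by rw [Complex.arg_ofReal_of_nonneg ht.le]; simpa⟩

theorem isOpen_openSector {θ : ℝ} (hθ : θ ≤ Real.pi / 2) : IsOpen (openSector θ) := by
  rw [isOpen_iff_mem_nhds]
  rintro z ⟨hz, hza⟩
  have hs : z ∈ Complex.slitPlane := by
    refine Complex.mem_slitPlane_iff_arg.2 ⟨fun h => ?_, hz⟩
    rw [h, abs_of_pos Real.pi_pos] at hza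
    linarith [Real.pi_pos]
  have h1 := (Complex.continuousAt_arg hs).abs.eventually_lt continuousAt_const hza
  filter_upwards [h1, isOpen_ne.mem_nhds hz] with w hw hw0 using ⟨hw0, hw⟩

/-- Otherwise the norms blow up along a sequence tending to 0 in the sector, against
Banach-Steinhaus, since the operators converge strongly along it. -/
theorem IsSectorialSemigroup.exists_norm_le {Y : Type*} [NormedAddCommGroup Y] [NormedSpace ℂ Y]
    [CompleteSpace Y] {θ : ℝ} {T : ℂ → Y →L[ℂ] Y} (hT : IsSectorialSemigroup θ T) :
    ∃ δ C : ℝ, 0 < δ ∧ 0 < C ∧ ∀ z ∈ openSector θ, ‖z‖ < δ → ‖T z‖ ≤ C := by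
  by_contra! hcon
  have hex : ∀ n : ℕ, ∃ z ∈ openSector θ, ‖z‖ < 1 / ((n : ℝ) + 1) ∧ (n : ℝ) + 1 < ‖T z‖ :=
    fun n => hcon _ _ (by positivity) (by positivity)
  choose z hz hzn hTz using hex
  have hlim : Tendsto z atTop (𝓝[openSector θ] 0) := by
    refine tendsto_nhdsWithin_iff.2 ⟨?_, Eventually.of_forall hz⟩
    exact squeeze_zero_norm (fun n => (hzn n).le) tendsto_one_div_add_atTop_nhds_zero_nat
  obtain ⟨C, hC⟩ := banach_steinhaus (g := fun n => T (z n)) fun y => by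
    obtain ⟨C, hC⟩ := ((hT.tendsto y).comp hlim).norm.bddAbove_range
    exact ⟨C, fun n => hC ⟨n, rfl⟩⟩
  obtain ⟨n, hn⟩ := exists_nat_gt C
  linarith [hTz n, hC n]

namespace C0Semigroup

variable {𝕜 : Type*} [RCLike 𝕜] {X : Type*} [NormedAddCommGroup X] [InnerProductSpace 𝕜 X]
  (S : C0Semigroup 𝕜 X)

theorem exists_norm_op_le [CompleteSpace X] (t₀ : ℝ≥0) :
    ∃ C : ℝ, 0 < C ∧ ∀ t ≤ t₀, ‖S.op t‖ ≤ C := by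
  obtain ⟨C, hC⟩ := banach_steinhaus (g := fun t : Set.Icc (0 : ℝ≥0) t₀ => S.op t) fun x => by
    obtain ⟨C, hC⟩ := (isCompact_Icc.image (S.continuous_orbit x)).isBounded.exists_norm_le
    exact ⟨C, fun t => hC _ ⟨t, t.2, rfl⟩⟩
  exact ⟨max C 1, by positivity, fun t ht => (hC ⟨t, zero_le, ht⟩).trans (le_max_left _ _)⟩

variable {S}

/-- Holomorphy in operator norm gives norm continuity away from 0, which makes the outputs and the
integrands in X₋₁ strongly measurable. -/
theorem IsAnalytic.continuousOn_op (hS : S.IsAnalytic) : ContinuousOn S.op (Set.Ioi 0) := by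
  obtain ⟨Y, _, _, _, ι, θ, T, hι, -, -, hθ, hθ2, hT, hTS⟩ := hS
  intro s hs
  have hs' : (0 : ℝ) < s := hs
  have hc : ContinuousAt T ((s : ℝ) : ℂ) := (hT.holomorphic.continuousOn).continuousAt
    ((isOpen_openSector hθ2).mem_nhds (ofReal_mem_openSector hθ hs'))
  have hc2 : ContinuousAt (fun t : ℝ≥0 => T ((t : ℝ) : ℂ)) s :=
    ContinuousAt.comp (f := fun t : ℝ≥0 => ((t : ℝ) : ℂ)) hc (by fun_prop)
  refine ContinuousAt.continuousWithinAt ?_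
  rw [ContinuousAt, tendsto_iff_norm_sub_tendsto_zero] at hc2 ⊢
  refine squeeze_zero (fun _ => norm_nonneg _) (fun t => ?_) hc2
  refine ContinuousLinearMap.opNorm_le_bound _ (norm_nonneg _) fun x => ?_
  rw [← hι, ← hι x, sub_apply, map_sub, ← hTS, ← hTS,
    ← sub_apply]
  exact ContinuousLinearMap.le_opNorm _ _

/-- The orbit is differentiable in the larger space `Y`, and its derivative is a limit of points of
the closed range of the isometry `ι`, hence comes from `X`. -/
theorem IsAnalytic.exists_hasGeneratorValue [CompleteSpace X] (hS : S.IsAnalytic) {s : ℝ≥0}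
    (hs : 0 < s) (x : X) : ∃ y, S.HasGeneratorValue (S.op s x) y := by
  obtain ⟨Y, _, _, _, ι, θ, T, hι, hsm, -, hθ, hθ2, hT, hTS⟩ := hS
  have hs' : (0 : ℝ) < s := hs
  have hd : HasDerivAt T (deriv T ((s : ℝ) : ℂ)) ((s : ℝ) : ℂ) := (hT.holomorphic.differentiableAt
    ((isOpen_openSector hθ2).mem_nhds (ofReal_mem_openSector hθ hs'))).hasDerivAt
  have hto : Tendsto (fun h : ℝ≥0 => ((h : ℝ) : ℂ)) (𝓝[>] 0) (𝓝[≠] 0) := by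
    refine tendsto_nhdsWithin_iff.2 ⟨?_, ?_⟩
    · exact (Continuous.tendsto' (by fun_prop) 0 0 (by simp)).mono_left nhdsWithin_le_nhds
    · filter_upwards [self_mem_nhdsWithin] with h hh
      simpa using (ne_of_gt hh)
  have hlim := (hasDerivAt_iff_tendsto_slope_zero.1 hd).comp hto
  have hlim2 := ((ContinuousLinearMap.apply ℂ Y (ι x)).continuous.tendsto _).comp hlim
  have hiso : Isometry ι := AddMonoidHomClass.isometry_of_norm ι hι
  set f : ℝ≥0 → X := fun h => (((h : ℝ) : 𝕜))⁻¹ • (S.op h (S.op s x) - S.op s x) with hf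
  have hιf : Tendsto (fun h => ι (f h)) (𝓝[>] 0) (𝓝 (deriv T ((s : ℝ) : ℂ) (ι x))) := by
    refine hlim2.congr fun h => ?_
    simp only [Function.comp_apply, ContinuousLinearMap.apply_apply, hf]
    rw [← RCLike.ofReal_inv, hsm, map_sub, ← ContinuousLinearMap.comp_apply, ← S.op_add, ← hTS,
      ← hTS]
    simp [add_comm]
  have hmem : deriv T ((s : ℝ) : ℂ) (ι x) ∈ Set.range ι := 
    hiso.isClosedEmbedding.isClosed_range.mem_of_tendsto hιf (Eventually.of_forall fun h => ⟨_, rfl⟩)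
  obtain ⟨y, hy⟩ := hmem
  rw [← hy] at hιf
  exact ⟨y, hiso.isEmbedding.tendsto_nhds_iff.2 hιf⟩

/-- The real parts of the matrix coefficients of an analytic semigroup extend holomorphically. -/
theorem IsAnalytic.exists_holomorphic_coefficient (hS : S.IsAnalytic) :
    ∃ r δ C : ℝ, 0 < r ∧ r < 1 ∧ 0 < δ ∧ 0 < C ∧ ∀ ψ x : X, ∃ H : ℂ → ℂ,
      (∀ s : ℝ, 0 < s → DifferentiableOn ℂ H (Metric.ball (s : ℂ) (r * s))) ∧
      (∀ s : ℝ, 0 < s → s < δ → ∀ z ∈ Metric.ball (s : ℂ) (r * s), ‖H z‖ ≤ C * ‖ψ‖ * ‖x‖) ∧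
      ∀ t : ℝ≥0, (H ((t : ℝ) : ℂ)).re = RCLike.re (inner 𝕜 ψ (S.op t x)) := by
  obtain ⟨Y, _, _, _, ι, θ, T, hι, hsm, -, hθ, hθ2, hT, hTS⟩ := hS
  obtain ⟨r, hr0, hr1, hball⟩ := exists_ball_subset_openSector hθ
  obtain ⟨δ, C, hδ, hC, hTC⟩ := hT.exists_norm_le
  -- Half of δ, since the disc around `s` reaches up to modulus (1 + r)s < 2s.
  refine ⟨r, δ / 2, C, hr0, hr1, by positivity, hC, fun ψ x => ?_⟩
  let _ : NormedSpace ℝ X := NormedSpace.restrictScalars ℝ 𝕜 X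
  have hsmul : ∀ (a : ℝ) (x : X), a • x = (a : 𝕜) • x := fun a x => rfl
  let ιl : X →ₗ[ℝ] Y :=
    { toFun := ι
      map_add' := map_add ι
      map_smul' := fun a x => by rw [hsmul, hsm]; simp }
  let l : X →ₗ[ℝ] ℝ :=
    { toFun := fun x => RCLike.re (inner 𝕜 ψ x)
      map_add' := fun x y => by rw [inner_add_right, map_add]
      map_smul' := fun a x => by rw [hsmul, inner_smul_right]; simp }
  -- The map `ι` is only real linear, so only the real functional Re⟨ψ, ·⟩ is carried over to `Y`;
  -- it is complexified there with the same norm.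
  obtain ⟨g, hg, hgl⟩ := exists_dual_of_norm_le ιl l (norm_nonneg ψ) fun v => by
    change |RCLike.re (inner 𝕜 ψ v)| ≤ ‖ψ‖ * ‖ι v‖
    rw [hι]
    exact (RCLike.abs_re_le_norm _).trans (norm_inner_le_norm _ _)
  let F : Y →L[ℂ] ℂ := StrongDual.extendRCLike (𝕜 := ℂ) g
  have hF : ‖F‖ ≤ ‖ψ‖ := by rw [StrongDual.norm_extendRCLike]; exact hg
  have hFre : ∀ y, (F y).re = g y := fun y => by
    have : RCLike.re (F y) = g y := by simp [F]
    exact this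
  refine ⟨fun z => F (T z (ι x)), fun s hs => ?_, fun s hs hsδ z hz => ?_, fun t => ?_⟩
  · have : DifferentiableOn ℂ (fun z => T z (ι x)) (Metric.ball (s : ℂ) (r * s)) :=
      (hT.holomorphic.mono (hball s hs)).clm_apply (differentiableOn_const _)
    exact F.differentiable.comp_differentiableOn this
  · have hz1 : ‖z‖ < δ := by
      rw [Metric.mem_ball, dist_eq_norm] at hz
      have h1 : ‖z‖ ≤ ‖z - s‖ + ‖(s : ℂ)‖ := by simpa using norm_add_le (z - s) (s : ℂ)
      rw [Complex.norm_real, Real.norm_of_nonneg hs.le] at h1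
      nlinarith
    calc ‖F (T z (ι x))‖ ≤ ‖F‖ * (‖T z‖ * ‖ι x‖) :=
          (F.le_opNorm _).trans (by gcongr; exact ContinuousLinearMap.le_opNorm _ _)
      _ ≤ ‖ψ‖ * (C * ‖x‖) := by
          rw [hι]
          gcongr
          exact hTC z (hball s hs hz) hz1
      _ = _ := by ring
  · rw [hFre, hTS]
    exact hgl _

variable [CompleteSpace X]

@[simp]
theorem adjointOp_fst (t : ℝ≥0) (p : S.adjointDomain) :
    (S.adjointOp t p : WithLp 2 (X × X)).fst = (S.op t).adjoint (p : WithLp 2 (X × X)).fst := rfl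

@[simp]
theorem adjointOp_snd (t : ℝ≥0) (p : S.adjointDomain) :
    (S.adjointOp t p : WithLp 2 (X × X)).snd = (S.op t).adjoint (p : WithLp 2 (X × X)).snd := rfl

theorem adjointDomain_ext {p q : S.adjointDomain}
    (h1 : (p : WithLp 2 (X × X)).fst = (q : WithLp 2 (X × X)).fst)
    (h2 : (p : WithLp 2 (X × X)).snd = (q : WithLp 2 (X × X)).snd) : p = q :=
  Subtype.ext (WithLp.ofLp_injective 2 (Prod.ext h1 h2))

theorem adjointOp_add (s t : ℝ≥0) (p : S.adjointDomain) :
    S.adjointOp (s + t) p = S.adjointOp s (S.adjointOp t p) := by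
  refine adjointDomain_ext ?_ ?_ <;>
  · simp only [adjointOp_fst, adjointOp_snd]
    rw [add_comm, S.op_add, ContinuousLinearMap.adjoint_comp, ContinuousLinearMap.comp_apply]

theorem norm_le_of_fst_snd {p q : S.adjointDomain} {C : ℝ} (hC : 0 ≤ C)
    (h1 : ‖(p : WithLp 2 (X × X)).fst‖ ≤ C * ‖(q : WithLp 2 (X × X)).fst‖)
    (h2 : ‖(p : WithLp 2 (X × X)).snd‖ ≤ C * ‖(q : WithLp 2 (X × X)).snd‖) : ‖p‖ ≤ C * ‖q‖ := by
  rw [← Submodule.norm_coe, ← Submodule.norm_coe, WithLp.prod_norm_eq_of_L2, WithLp.prod_norm_eq_of_L2]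
  rw [← Real.sqrt_sq hC, ← Real.sqrt_mul (sq_nonneg C)]
  apply Real.sqrt_le_sqrt
  rw [mul_add, ← mul_pow, ← mul_pow]
  gcongr

theorem norm_adjointOp_le (t : ℝ≥0) : ‖S.adjointOp t‖ ≤ ‖S.op t‖ := by
  refine ContinuousLinearMap.opNorm_le_bound _ (norm_nonneg _) fun p => ?_
  rw [← LinearIsometryEquiv.norm_map ContinuousLinearMap.adjoint (S.op t)]
  exact norm_le_of_fst_snd (norm_nonneg _)
    ((S.op t).adjoint.le_opNorm (p : WithLp 2 (X × X)).fst)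
    ((S.op t).adjoint.le_opNorm (p : WithLp 2 (X × X)).snd)

theorem norm_adjointOp_sub_le (t s : ℝ≥0) :
    ‖S.adjointOp t - S.adjointOp s‖ ≤ ‖S.op t - S.op s‖ := by
  refine ContinuousLinearMap.opNorm_le_bound _ (norm_nonneg _) fun p => ?_
  rw [← LinearIsometryEquiv.norm_map ContinuousLinearMap.adjoint (S.op t - S.op s), map_sub]
  exact norm_le_of_fst_snd (norm_nonneg _)
    (((S.op t).adjoint - (S.op s).adjoint).le_opNorm (p : WithLp 2 (X × X)).fst)
    (((S.op t).adjoint - (S.op s).adjoint).le_opNorm (p : WithLp 2 (X × X)).snd)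

theorem IsAnalytic.continuousOn_adjointOp (hS : S.IsAnalytic) :
    ContinuousOn S.adjointOp (Set.Ioi 0) := by
  intro s hs
  have h := hS.continuousOn_op s hs
  rw [ContinuousWithinAt, tendsto_iff_norm_sub_tendsto_zero] at h
  refine (tendsto_iff_norm_sub_tendsto_zero (E := S.adjointDomain →L[𝕜] S.adjointDomain)).2 ?_
  exact squeeze_zero (fun t => ContinuousLinearMap.opNorm_nonneg _)
    (fun t => norm_adjointOp_sub_le t s) h

/-- Riesz representation of the elements of `X₋₁`. -/
theorem exists_representation (ξ : S.Xneg) : ∃ a b : X, ‖a‖ ≤ ‖ξ‖ ∧ ‖b‖ ≤ ‖ξ‖ ∧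
    ∀ p : S.adjointDomain, ξ p = inner 𝕜 (p : WithLp 2 (X × X)).fst a +
      inner 𝕜 (p : WithLp 2 (X × X)).snd b := by
  let l : S.adjointDomain →ₗ[𝕜] 𝕜 :=
    { toFun := fun p => starRingEnd 𝕜 (ξ p)
      map_add' := fun p q => by rw [map_add, map_add]
      map_smul' := fun c p => by simp }
  obtain ⟨g, hg, hgl⟩ := exists_dual_of_norm_le S.adjointDomain.subtype l (norm_nonneg ξ) fun v => by
    change ‖starRingEnd 𝕜 (ξ v)‖ ≤ ‖ξ‖ * ‖v‖
    rw [RCLike.norm_conj]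
    exact ξ.le_opNorm v
  set w := (InnerProductSpace.toDual 𝕜 (WithLp 2 (X × X))).symm g with hw
  have hwn : ‖w‖ ≤ ‖ξ‖ := by rw [hw, LinearIsometryEquiv.norm_map]; exact hg
  refine ⟨w.fst, w.snd, (WithLp.norm_fst_le _ _).trans hwn, (WithLp.norm_snd_le _ _).trans hwn, fun p => ?_⟩
  have h1 : inner 𝕜 w (p : WithLp 2 (X × X)) = starRingEnd 𝕜 (ξ p) := by
    rw [hw, InnerProductSpace.toDual_symm_apply]
    exact hgl p
  have h2 := congrArg (starRingEnd 𝕜) h1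
  rw [inner_conj_symm, RCLike.conj_conj] at h2
  rw [← h2, WithLp.prod_inner_apply]
  rfl

/-- Since S(s)b ∈ D(A), ⟨A*φ, S(s)b⟩ = ⟨φ, AS(s)b⟩ is the derivative of ⟨φ, S(s)b⟩. This removes
A*φ, so that later bounds involve only the norm of φ in `X` and not the graph norm. -/
theorem IsAnalytic.inner_snd_eq_deriv (hS : S.IsAnalytic) (p : S.adjointDomain) (b : X) {s : ℝ≥0}
    (hs : 0 < s) {H : ℂ → ℂ} (hd : DifferentiableAt ℂ H ((s : ℝ) : ℂ))
    (hH : ∀ t : ℝ≥0, (H ((t : ℝ) : ℂ)).re =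
      RCLike.re (inner 𝕜 (p : WithLp 2 (X × X)).fst (S.op t b))) :
    (deriv H ((s : ℝ) : ℂ)).re =
      RCLike.re (inner 𝕜 (p : WithLp 2 (X × X)).snd (S.op s b)) := by
  obtain ⟨y, hy⟩ := hS.exists_hasGeneratorValue hs b
  obtain ⟨hx, hxy⟩ := S.generator_eq hy
  have h1 := (S.mem_adjointDomain_iff _).1 p.2 ⟨_, hx⟩
  rw [hxy] at h1
  rw [← h1]
  have hto : Tendsto (fun h : ℝ≥0 => ((h : ℝ) : ℂ)) (𝓝[>] 0) (𝓝[≠] 0) := by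
    refine tendsto_nhdsWithin_iff.2 ⟨?_, ?_⟩
    · exact (Continuous.tendsto' (by fun_prop) 0 0 (by simp)).mono_left nhdsWithin_le_nhds
    · filter_upwards [self_mem_nhdsWithin] with h hh
      simpa using (ne_of_gt hh)
  have hlim := (hasDerivAt_iff_tendsto_slope_zero.1 hd.hasDerivAt).comp hto
  have hlim2 := (Complex.continuous_re.tendsto _).comp hlim
  have hcont : Continuous fun v : X => RCLike.re (inner 𝕜 (p : WithLp 2 (X × X)).fst v) := by fun_prop
  refine tendsto_nhds_unique hlim2 (((hcont.tendsto _).comp hy).congr fun h => ?_)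
  simp only [Function.comp_apply]
  rw [← RCLike.ofReal_inv, inner_smul_right, RCLike.re_ofReal_mul, inner_sub_right, map_sub,
    ← ContinuousLinearMap.comp_apply, ← S.op_add, ← hH, ← hH, ← Complex.ofReal_inv, smul_eq_mul,
    Complex.re_ofReal_mul, Complex.sub_re, add_comm h s]
  push_cast
  rfl

/-- The outputs `t ↦ ξ (S(t)* ψ)` of an analytic semigroup extend holomorphically. -/
theorem IsAnalytic.exists_holomorphic_output (hS : S.IsAnalytic) :
    ∃ r δ C : ℝ, 0 < r ∧ r < 1 ∧ 0 < δ ∧ 0 < C ∧ ∀ (ξ : S.Xneg) (ψ : S.adjointDomain) (s : ℝ),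
      0 < s → s < δ → ∃ H : ℂ → ℂ, DifferentiableOn ℂ H (Metric.ball (s : ℂ) (2 * (r * s))) ∧
        (∀ z ∈ Metric.ball (s : ℂ) (2 * (r * s)),
          ‖H z‖ ≤ C / s * ‖ξ‖ * ‖(ψ : WithLp 2 (X × X)).fst‖) ∧
        ∀ x : ℝ, |x - s| < 2 * (r * s) →
          (H x).re = RCLike.re (ξ (S.adjointOp x.toNNReal ψ)) := by
  obtain ⟨r, δ, C, hr0, hr1, hδ, hC, hex⟩ := hS.exists_holomorphic_coefficient
  -- The smaller disc of radius rs/2 leaves room for Cauchy circles of radius rs/4, at the price of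
  -- a factor 1/s. The bound s < 1 absorbs the undifferentiated term into the same factor.
  refine ⟨r / 4, min δ 1, C * (1 + 4 / r), by positivity, by linarith, by positivity,
    by positivity, fun ξ ψ s hs hsδ => ?_⟩
  obtain ⟨a, b, ha, hb, hab⟩ := S.exists_representation ξ
  set p := (ψ : WithLp 2 (X × X)).fst with hp
  obtain ⟨F, hFd, hFb, hF⟩ := hex p a
  obtain ⟨G, hGd, hGb, hG⟩ := hex p b
  have hsδ' : s < δ := hsδ.trans_le (min_le_left _ _)
  have hs1 : s < 1 := hsδ.trans_le (min_le_right _ _)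
  have hrs : 0 < r * s := by positivity
  have hsub : Metric.ball (s : ℂ) (2 * (r / 4 * s)) ⊆ Metric.ball (s : ℂ) (r * s) :=
    Metric.ball_subset_ball (by linarith)
  have hder : ∀ z ∈ Metric.ball (s : ℂ) (2 * (r / 4 * s)),
      ‖deriv G z‖ ≤ C * ‖p‖ * ‖b‖ / (r * s / 4) := by
    intro z hz
    have hcb : Metric.closedBall z (r * s / 4) ⊆ Metric.ball (s : ℂ) (r * s) := by
      refine Metric.closedBall_subset_ball' ?_
      have := Metric.mem_ball.1 hz
      linarith
    refine Complex.norm_deriv_le_of_forall_mem_sphere_norm_le (by positivity)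
      (DifferentiableOn.diffContOnCl ?_)
      (fun w hw => hGb s hs hsδ' w (hcb (Metric.sphere_subset_closedBall hw)))
    rw [closure_ball _ (by positivity)]
    exact (hGd s hs).mono hcb
  refine ⟨fun z => F z + deriv G z, ?_, fun z hz => ?_, fun x hx => ?_⟩
  · exact ((hFd s hs).mono hsub).add (((hGd s hs).deriv Metric.isOpen_ball).mono hsub)
  · have h1 : ‖F z‖ ≤ C * ‖p‖ * ‖ξ‖ :=
      (hFb s hs hsδ' z (hsub hz)).trans (by gcongr)
    have h2 : ‖deriv G z‖ ≤ C * ‖p‖ * ‖ξ‖ / (r * s / 4) := (hder z hz).trans (by gcongr)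
    have h3 : C * ‖p‖ * ‖ξ‖ ≤ C * ‖p‖ * ‖ξ‖ / s := by
      rw [le_div_iff₀ hs]
      have : 0 ≤ C * ‖p‖ * ‖ξ‖ := by positivity
      nlinarith
    refine (norm_add_le _ _).trans ((add_le_add (h1.trans h3) h2).trans_eq ?_)
    field_simp
  · have hx0 : 0 < x := by
      have := (abs_lt.1 hx).1
      nlinarith
    have hmem : (x : ℂ) ∈ Metric.ball (s : ℂ) (r * s) := by
      rw [Metric.mem_ball, dist_eq_norm, ← Complex.ofReal_sub, Complex.norm_real, Real.norm_eq_abs]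
      linarith
    have hxc : ((x.toNNReal : ℝ≥0) : ℝ) = x := Real.coe_toNNReal x hx0.le
    have hx0' : 0 < x.toNNReal := Real.toNNReal_pos.2 hx0
    have h1 := hF x.toNNReal
    have h2 := hS.inner_snd_eq_deriv ψ b hx0' (H := G) (by
      rw [hxc]; exact (hGd s hs).differentiableAt (Metric.isOpen_ball.mem_nhds hmem)) hG
    rw [hxc] at h1 h2
    rw [Complex.add_re, h1, h2, hab, map_add, adjointOp_fst, adjointOp_snd,
      ContinuousLinearMap.adjoint_inner_left, ContinuousLinearMap.adjoint_inner_left]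

end C0Semigroup

/-! ### Markov's inequality, density points and telescoping weights -/

/-- Markov's inequality turns an integral over `A` into a pointwise bound on half of the guaranteed
measure, as needed for the Remez step. -/
theorem ofReal_half_le_volume_le_average {A : Set ℝ} (hA : MeasurableSet A) {g : ℝ → ℝ}
    (hg : IntegrableOn g A) (hg0 : ∀ x, 0 ≤ g x) {m : ℝ} (hm : 0 < m)
    (hv : ENNReal.ofReal m ≤ volume A) :
    ENNReal.ofReal (m / 2) ≤ volume {x ∈ A | g x ≤ 2 / m * ∫ y in A, g y} := by
  set I := ∫ y in A, g y with hI
  have hI0 : 0 ≤ I := integral_nonneg hg0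
  have hbad : volume {x ∈ A | 2 / m * I < g x} ≤ ENNReal.ofReal (m / 2) := by
    -- For zero integral the threshold is 0 and Markov says nothing; there `g` vanishes almost
    -- everywhere.
    rcases hI0.eq_or_lt with h0 | h0
    · have h1 : g =ᵐ[volume.restrict A] 0 :=
        (integral_eq_zero_iff_of_nonneg hg0 hg).1 h0.symm
      have h2 : volume.restrict A {x | 2 / m * I < g x} = 0 := by
        refine measure_mono_null (fun x hx => ?_) (ae_iff.1 h1)
        rw [Set.mem_ofPred_eq, ← h0, mul_zero] at hx
        exact ne_of_gt hx
      rw [Measure.restrict_apply' hA] at h2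
      rw [show {x ∈ A | 2 / m * I < g x} = {x | 2 / m * I < g x} ∩ A by ext; simp [and_comm], h2]
      exact zero_le
    · have h1 := mul_meas_ge_le_integral_of_nonneg (μ := volume.restrict A)
        (Eventually.of_forall hg0) hg (2 / m * I)
      rw [← hI] at h1
      have h2 : (volume.restrict A).real {x | 2 / m * I ≤ g x} ≤ m / 2 := by
        have e : 2 / m * I * (volume.restrict A).real {x | 2 / m * I ≤ g x} =
          I * (2 / m * (volume.restrict A).real {x | 2 / m * I ≤ g x}) := by ring
        rw [e] at h1
        have h3 : 2 / m * (volume.restrict A).real {x | 2 / m * I ≤ g x} ≤ 1 := by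
          by_contra! hcon
          nlinarith
        rw [div_mul_eq_mul_div, div_le_one hm] at h3
        linarith
      have h4 : volume.restrict A {x | 2 / m * I ≤ g x} ≠ ⊤ :=
        (hg.measure_ge_lt_top (by positivity)).ne
      rw [measureReal_def] at h2
      have h5 := (ENNReal.le_ofReal_iff_toReal_le h4 (by positivity)).2 h2
      rw [Measure.restrict_apply' hA] at h5
      refine (measure_mono ?_).trans h5
      exact fun x hx => ⟨le_of_lt hx.2, hx.1⟩
  have hun : A ⊆ {x ∈ A | g x ≤ 2 / m * I} ∪ {x ∈ A | 2 / m * I < g x} := fun x hx => by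
    rcases le_or_gt (g x) (2 / m * I) with h | h
    · exact Or.inl ⟨hx, h⟩
    · exact Or.inr ⟨hx, h⟩
  have h1 := hv.trans ((measure_mono hun).trans (measure_union_le _ _))
  have h2 : ENNReal.ofReal m = ENNReal.ofReal (m / 2) + ENNReal.ofReal (m / 2) := by
    rw [← ENNReal.ofReal_add (by positivity) (by positivity)]; simp
  rw [h2] at h1
  exact ENNReal.le_of_add_le_add_right (by simp) (h1.trans (by gcongr))

theorem exists_density_point {E : Set ℝ} (hE : MeasurableSet E) (hE0 : volume E ≠ 0) {η : ℝ}
    (hη : 0 < η) : ∃ l ∈ E, ∃ a > 0, ∀ h : ℝ, 0 < h → h < a →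
      volume (Set.Icc l (l + h) \ E) ≤ ENNReal.ofReal (η * h) := by
  have h1 := Besicovitch.ae_tendsto_measure_inter_div (volume : Measure ℝ) E
  have hne : (ae (volume.restrict E)).NeBot := by
    rw [ae_neBot]; simpa using hE0
  obtain ⟨l, hl, hlE⟩ := (h1.and (ae_restrict_mem hE)).exists
  -- Density concerns the two-sided interval of length 2h, so a missing fraction η/2 there means at
  -- most ηh on the right half.
  have hlt : 1 - ENNReal.ofReal (η / 2) < 1 := ENNReal.sub_lt_self (by simp) (by simp) (by simpa using hη)
  have h2 := hl.eventually_const_lt hlt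
  obtain ⟨a, ha, h3⟩ := mem_nhdsGT_iff_exists_Ioo_subset.1 h2
  refine ⟨l, hlE, a, ha, fun h hh0 hha => ?_⟩
  have h4 : 1 - ENNReal.ofReal (η / 2) < _ := h3 ⟨hh0, hha⟩
  have hvb : volume (Metric.closedBall l h) = ENNReal.ofReal (2 * h) := Real.volume_closedBall l h
  have h5 : volume (Metric.closedBall l h \ E) ≤ ENNReal.ofReal (η * h) := by
    rw [ENNReal.lt_div_iff_mul_lt (by left; rw [hvb]; simpa using hh0) (by left; rw [hvb]; exact ENNReal.ofReal_ne_top)] at h4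
    have h6 := measure_inter_add_sdiff (μ := volume) (Metric.closedBall l h) hE
    rw [Set.inter_comm] at h6
    have h7 : volume (Metric.closedBall l h) ≤ (1 - ENNReal.ofReal (η / 2)) *
        volume (Metric.closedBall l h) + ENNReal.ofReal (η * h) := by
      rw [hvb, show η * h = η / 2 * (2 * h) by ring,
        ENNReal.ofReal_mul (p := η / 2) (by positivity), ← add_mul]
      calc ENNReal.ofReal (2 * h) = 1 * ENNReal.ofReal (2 * h) := (one_mul _).symm
        _ ≤ _ := by gcongr; exact le_tsub_add
    have h8 := h6.trans_le (h7.trans (add_le_add_left h4.le _))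
    exact (ENNReal.add_le_add_iff_left (ne_top_of_le_ne_top (by rw [hvb]; exact ENNReal.ofReal_ne_top)
      (measure_mono Set.inter_subset_right))).1 h8
  refine (measure_mono (Set.sdiff_subset_sdiff_left fun x hx => ?_)).trans h5
  rw [Real.closedBall_eq_Icc]
  exact ⟨by linarith [hx.1], hx.2⟩

/-- As ρ^k = 1/2, the exponent D/(Lρ^m)^k doubles with each `m`, so degrees N·2^m keep pace. The
weights make the first inequality an equality. With Q = 100^(N·2^m), the second side carries Q⁻³
while the next weight carries only Q⁻², and the spare Q absorbs the exponential. -/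
theorem exists_telescoping_weights {k D c₁ c₂ L : ℝ} (hD : 0 ≤ D) (hc₁ : 0 < c₁)
    (hL : 0 < L) {ρ : ℝ} (hρ0 : 0 < ρ) (hρ1 : ρ < 1) (hρ : ρ ^ k = 1 / 2) :
    ∃ (w : ℕ → ℝ) (n : ℕ → ℕ), (∀ m, 0 < w m) ∧ Tendsto w atTop (𝓝 0) ∧ ∀ m,
      w m * (Real.exp (D / (L * ρ ^ m) ^ k) / (L * ρ ^ m) * (100 ^ n m * c₁)) ≤ 1 ∧
      w m * (Real.exp (D / (L * ρ ^ m) ^ k) / (L * ρ ^ m) * (c₂ * (1 / 10000) ^ n m)) ≤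
        w (m + 1) := by
  obtain ⟨D', hD'⟩ : ∃ D', D' = D / L ^ k := ⟨_, rfl⟩
  have hLk : 0 < L ^ k := Real.rpow_pos_of_pos hL k
  have hD'0 : 0 ≤ D' := by rw [hD']; positivity
  have hexp : ∀ m : ℕ, D / (L * ρ ^ m) ^ k = D' * 2 ^ m := by
    intro m
    rw [Real.mul_rpow hL.le (by positivity), ← Real.rpow_natCast ρ m, ← Real.rpow_mul hρ0.le,
      mul_comm (m : ℝ) k, Real.rpow_mul hρ0.le, hρ, Real.rpow_natCast, hD', one_div, inv_pow]
    field_simp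
  obtain ⟨a, ha⟩ : ∃ a, a = max 1 (c₂ / L) := ⟨_, rfl⟩
  have ha1 : 1 ≤ a := by rw [ha]; exact le_max_left _ _
  have ha2 : c₂ ≤ L * a := by
    have : c₂ / L ≤ a := by rw [ha]; exact le_max_right _ _
    rw [div_le_iff₀ hL] at this
    linarith
  -- Raised to the power 2^m, this dominates exp(D'·2^(m+1)) ρ^(-(m+1)) a for every `m` at once.
  obtain ⟨N, hN⟩ : ∃ N : ℕ, Real.exp (2 * D') * ρ⁻¹ * a < 100 ^ N :=
    pow_unbounded_of_one_lt _ (by norm_num)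
  have hρi : 1 < ρ⁻¹ := (one_lt_inv₀ hρ0).2 hρ1
  have hN1 : 1 ≤ N := by
    by_contra! h
    have h0 : N = 0 := by omega
    rw [h0, pow_zero] at hN
    have h1 : 1 ≤ Real.exp (2 * D') := Real.one_le_exp (by positivity)
    have h2 : 1 ≤ Real.exp (2 * D') * ρ⁻¹ * a :=
      one_le_mul_of_one_le_of_one_le (one_le_mul_of_one_le_of_one_le h1 hρi.le) ha1
    linarith
  have hmain : ∀ m : ℕ, Real.exp (D' * 2 ^ (m + 1)) * (ρ⁻¹) ^ (m + 1) * a ≤ 100 ^ (N * 2 ^ m) := by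
    intro m
    have h1 : (Real.exp (2 * D') * ρ⁻¹ * a) ^ (2 ^ m) ≤ 100 ^ (N * 2 ^ m) := by
      rw [pow_mul]; gcongr
    refine le_trans ?_ h1
    rw [mul_pow, mul_pow, ← Real.exp_nat_mul]
    have h2 : D' * 2 ^ (m + 1) = ((2 ^ m : ℕ) : ℝ) * (2 * D') := by push_cast; ring
    rw [h2]
    gcongr
    · exact hρi.le
    · exact Nat.lt_two_pow_self
    · exact le_self_pow₀ ha1 (by positivity)
  refine ⟨fun m => L * ρ ^ m / c₁ * Real.exp (-(D' * 2 ^ m)) * (100 ^ (N * 2 ^ m))⁻¹,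
    fun m => N * 2 ^ m, fun m => by positivity, ?_, fun m => ⟨?_, ?_⟩⟩
  · have hg : Tendsto (fun m : ℕ => L / c₁ * (1 / 100 : ℝ) ^ m) atTop (𝓝 0) := by
      simpa using (tendsto_pow_atTop_nhds_zero_of_lt_one (by norm_num : (0 : ℝ) ≤ 1 / 100)
        (by norm_num)).const_mul (L / c₁)
    refine squeeze_zero (fun m => by positivity) (fun m => ?_) hg
    have h1 : Real.exp (-(D' * 2 ^ m)) ≤ 1 := Real.exp_le_one_iff.2 (by simp; positivity)
    have h2 : ρ ^ m ≤ 1 := pow_le_one₀ hρ0.le hρ1.le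
    have h3 : ((100 : ℝ) ^ (N * 2 ^ m))⁻¹ ≤ (1 / 100) ^ m := by
      rw [one_div, inv_pow]
      gcongr
      · norm_num
      · calc m ≤ 2 ^ m := Nat.lt_two_pow_self.le
          _ ≤ N * 2 ^ m := Nat.le_mul_of_pos_left _ hN1
    calc _ ≤ L * 1 / c₁ * 1 * (1 / 100) ^ m := by gcongr
      _ = _ := by ring
  · rw [hexp]
    beta_reduce
    rw [Real.exp_neg]
    have := Real.exp_pos (D' * 2 ^ m)
    apply le_of_eq
    field_simp
  · have h := hmain m
    rw [hexp]
    beta_reduce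
    have e0 : (0 : ℝ) < 100 ^ (N * 2 ^ m) := by positivity
    have e1 : (1 / 10000 : ℝ) ^ (N * 2 ^ m) = (100 ^ (N * 2 ^ m))⁻¹ * (100 ^ (N * 2 ^ m))⁻¹ := by
      rw [← mul_inv, ← mul_pow, one_div, inv_pow]; norm_num
    have e2 : (100 : ℝ) ^ (N * 2 ^ (m + 1)) = 100 ^ (N * 2 ^ m) * 100 ^ (N * 2 ^ m) := by
      rw [← pow_add]; congr 1; ring
    rw [e1, e2, Real.exp_neg, Real.exp_neg]
    set Q : ℝ := 100 ^ (N * 2 ^ m) with hQ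
    have hE1 := Real.exp_pos (D' * 2 ^ m)
    have hE2 := Real.exp_pos (D' * 2 ^ (m + 1))
    have h3 : c₂ * Real.exp (D' * 2 ^ (m + 1)) ≤ L * ρ ^ (m + 1) * Q := by
      have h4 : L * ρ ^ (m + 1) * (Real.exp (D' * 2 ^ (m + 1)) * (ρ⁻¹) ^ (m + 1) * a) =
        L * a * Real.exp (D' * 2 ^ (m + 1)) := by
        rw [inv_pow]; field_simp
      calc _ ≤ L * a * Real.exp (D' * 2 ^ (m + 1)) := by gcongr
        _ = _ := h4.symm
        _ ≤ _ := by gcongr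
    have e3 : L * ρ ^ m / c₁ * (Real.exp (D' * 2 ^ m))⁻¹ * Q⁻¹ *
        (Real.exp (D' * 2 ^ m) / (L * ρ ^ m) * (c₂ * (Q⁻¹ * Q⁻¹))) = c₂ / (c₁ * Q * Q * Q) := by
      field_simp
    rw [e3]
    have e4 : L * ρ ^ (m + 1) / c₁ * (Real.exp (D' * 2 ^ (m + 1)))⁻¹ * (Q * Q)⁻¹ =
        L * ρ ^ (m + 1) * Q / (c₁ * Q * Q * Q * Real.exp (D' * 2 ^ (m + 1))) := by
      field_simp
    rw [e4, div_le_div_iff₀ (by positivity) (by positivity)]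
    calc c₂ * (c₁ * Q * Q * Q * Real.exp (D' * 2 ^ (m + 1))) =
        (c₂ * Real.exp (D' * 2 ^ (m + 1))) * (c₁ * Q * Q * Q) := by ring
      _ ≤ _ := by gcongr

/-! ### Observability from a set of times of positive measure -/

noncomputable section

theorem exists_bound_of_continuous {𝕜 E F : Type*} [RCLike 𝕜] [SeminormedAddCommGroup E]
    [NormedSpace 𝕜 E] [SeminormedAddCommGroup F] [NormedSpace 𝕜 F] (f : E → F)
    (hadd : ∀ x y, f (x + y) = f x + f y) (hsmul : ∀ (c : 𝕜) x, f (c • x) = c • f x)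
    (hf : Continuous f) : ∃ b : ℝ, 0 < b ∧ ∀ x, ‖f x‖ ≤ b * ‖x‖ := by
  let l : E →L[𝕜] F := { toFun := f, map_add' := hadd, map_smul' := hsmul, cont := hf }
  exact l.bound

namespace C0Semigroup

variable {𝕜 : Type*} [RCLike 𝕜] {X : Type*} [NormedAddCommGroup X] [InnerProductSpace 𝕜 X]
  [CompleteSpace X] {S : C0Semigroup 𝕜 X} {U : Type*} [NormedAddCommGroup U]
  [InnerProductSpace 𝕜 U] [CompleteSpace U]

/-- The output `t ↦ B* S(t)* φ`. -/
def output (B : U →L[𝕜] S.Xneg) (φ : S.adjointDomain) (t : ℝ) : U :=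
  S.adjointControl B (S.adjointOp t.toNNReal φ)

theorem inner_output (B : U →L[𝕜] S.Xneg) (φ : S.adjointDomain) (t : ℝ) (u : U) :
    inner 𝕜 (output B φ t) u = B u (S.adjointOp t.toNNReal φ) :=
  S.inner_adjointControl B _ u

omit [CompleteSpace U] in
theorem exists_norm_control_le (B : U →L[𝕜] S.Xneg) :
    ∃ b : ℝ, 0 < b ∧ ∀ u, ‖B u‖ ≤ b * ‖u‖ := by
  exact exists_bound_of_continuous (𝕜 := 𝕜) (F := S.Xneg) B B.map_add B.map_smul B.continuous

theorem norm_adjointControl_le {B : U →L[𝕜] S.Xneg} {b : ℝ} (hb : 0 ≤ b)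
    (hB : ∀ u, ‖B u‖ ≤ b * ‖u‖) (φ : S.adjointDomain) :
    ‖S.adjointControl B φ‖ ≤ b * ‖φ‖ := by
  rw [adjointControl, LinearIsometryEquiv.norm_map]
  refine ContinuousLinearMap.opNorm_le_bound _ (by positivity) fun u => ?_
  change ‖B u φ‖ ≤ _
  refine ((B u).le_opNorm φ).trans ?_
  calc _ ≤ b * ‖u‖ * ‖φ‖ := by gcongr; exact hB u
    _ = _ := by ring

theorem continuous_adjointControl (B : U →L[𝕜] S.Xneg) : Continuous (S.adjointControl B) :=
  (LinearIsometryEquiv.continuous _).comp B.flip.continuous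

theorem adjointControl_add (B : U →L[𝕜] S.Xneg) (φ ψ : S.adjointDomain) :
    S.adjointControl B (φ + ψ) = S.adjointControl B φ + S.adjointControl B ψ := by
  simp [adjointControl]

theorem adjointControl_smul (B : U →L[𝕜] S.Xneg) (c : 𝕜) (φ : S.adjointDomain) :
    S.adjointControl B (c • φ) = c • S.adjointControl B φ := by
  refine ext_inner_right 𝕜 fun u => ?_
  rw [inner_adjointControl, inner_smul_left, inner_adjointControl, map_smulₛₗ, smul_eq_mul]

theorem output_add_time (B : U →L[𝕜] S.Xneg) (φ : S.adjointDomain) {s t : ℝ} (hs : 0 ≤ s)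
    (ht : 0 ≤ t) : output B φ (s + t) = output B (S.adjointOp t.toNNReal φ) s := by
  rw [output, output, Real.toNNReal_add hs ht, adjointOp_add]

theorem IsAnalytic.continuousOn_output (hS : S.IsAnalytic) (B : U →L[𝕜] S.Xneg)
    (φ : S.adjointDomain) : ContinuousOn (output B φ) (Set.Ioi 0) := by
  refine (continuous_adjointControl B).comp_continuousOn ?_
  have h1 : ContinuousOn (fun t : ℝ => S.adjointOp t.toNNReal) (Set.Ioi 0) :=
    hS.continuousOn_adjointOp.comp continuous_real_toNNReal.continuousOn
      fun t ht => Real.toNNReal_pos.2 ht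
  exact h1.clm_apply continuousOn_const

theorem exists_norm_output_le (B : U →L[𝕜] S.Xneg) (φ : S.adjointDomain) (T : ℝ≥0) :
    ∃ C : ℝ, 0 < C ∧ ∀ t : ℝ, t ≤ T → ‖output B φ t‖ ≤ C := by
  obtain ⟨b, hb0, hB⟩ := exists_norm_control_le B
  obtain ⟨C, hC, hb⟩ := S.exists_norm_op_le T
  refine ⟨b * (C * ‖φ‖) + 1, by positivity, fun t ht => ?_⟩
  have h1 : ‖S.adjointOp t.toNNReal φ‖ ≤ C * ‖φ‖ :=
    ((S.adjointOp t.toNNReal).le_opNorm φ).trans (by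
      gcongr
      exact (norm_adjointOp_le _).trans (hb _ (Real.toNNReal_le_iff_le_coe.2 ht)))
  have h2 : ‖output B φ t‖ ≤ b * (C * ‖φ‖) := (norm_adjointControl_le hb0.le hB _).trans (by gcongr)
  linarith

theorem IsAnalytic.integrableOn_norm_output (hS : S.IsAnalytic) (B : U →L[𝕜] S.Xneg)
    (φ : S.adjointDomain) {A : Set ℝ} (hA : MeasurableSet A) {T : ℝ≥0}
    (hAT : A ⊆ Set.Ioc 0 (T : ℝ)) : IntegrableOn (fun t => ‖output B φ t‖) A := by
  obtain ⟨C, hC, hb⟩ := exists_norm_output_le B φ T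
  have hm : AEStronglyMeasurable (fun t => ‖output B φ t‖) (volume.restrict A) :=
    (((hS.continuousOn_output B φ).norm.aestronglyMeasurable measurableSet_Ioi).mono_measure
      (Measure.restrict_mono (fun t ht => (hAT ht).1) le_rfl))
  have : IsFiniteMeasure (volume.restrict A) :=
    isFiniteMeasure_restrict.2 (ne_top_of_le_ne_top (by simp) (measure_mono hAT))
  refine Integrable.of_bound hm C ?_
  · filter_upwards [ae_restrict_mem hA] with t ht
    rw [norm_norm]
    exact hb t (hAT ht).2

omit [CompleteSpace U] in
theorem norm_le_of_re_inner_le {v : U} {G : ℝ} (hG : 0 ≤ G)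
    (h : ∀ u : U, ‖u‖ ≤ 1 → RCLike.re (inner 𝕜 v u) ≤ G) : ‖v‖ ≤ G := by
  rcases eq_or_ne v 0 with rfl | hv
  · simpa using hG
  have hv' : 0 < ‖v‖ := norm_pos_iff.2 hv
  have := h (((‖v‖⁻¹ : ℝ) : 𝕜) • v) (by
    rw [norm_smul, RCLike.norm_ofReal, abs_of_pos (by positivity), inv_mul_cancel₀ hv'.ne'])
  rw [inner_smul_right, RCLike.re_ofReal_mul, inner_self_eq_norm_sq] at this
  calc ‖v‖ = ‖v‖⁻¹ * ‖v‖ ^ 2 := by field_simp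
    _ ≤ G := this

/-- Propagation of smallness for the outputs of an analytic semigroup. -/
theorem IsAnalytic.exists_norm_output_le_of_measure (hS : S.IsAnalytic) (B : U →L[𝕜] S.Xneg) :
    ∃ κ δ C : ℝ, 0 < κ ∧ κ < 1 ∧ 0 < δ ∧ 0 ≤ C ∧ ∀ (n : ℕ) (ψ : S.adjointDomain) (s ε : ℝ),
      0 < s → s < δ → 0 ≤ ε → ∀ A ⊆ Set.Icc (s - κ * s) s,
        ENNReal.ofReal (κ * s / 4) ≤ volume A → (∀ x ∈ A, ‖output B ψ x‖ ≤ ε) →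
          ∀ y ∈ Set.Icc (s - κ * s) s, ‖output B ψ y‖ ≤ 100 ^ n * ε +
            C / s * (1 / 10000) ^ n * ‖(ψ : WithLp 2 (X × X)).fst‖ := by
  obtain ⟨r, δ, C, hr0, hr1, hδ, hC, hex⟩ := hS.exists_holomorphic_output
  obtain ⟨b, hb0, hB⟩ := exists_norm_control_le B
  -- With q = 10⁻⁶ the Remez loss 100 leaves 100q = 10⁻⁴ = 100⁻² per degree. The estimate is scalar,
  -- for each test vector `u`, with constants independent of `u`.
  refine ⟨1 / 1000000 * r, δ, 4 * C * b, by positivity, by linarith, hδ, by positivity,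
    fun n ψ s ε hs hsδ hε A hA hv hb y hy => ?_⟩
  refine norm_le_of_re_inner_le (𝕜 := 𝕜) (by positivity) fun u hu => ?_
  obtain ⟨H, hHd, hHb, hH⟩ := hex (B u) ψ s hs hsδ
  have hrs : 0 < r * s := by positivity
  have hin : ∀ x ∈ Set.Icc (s - 1 / 1000000 * r * s) s, |x - s| < 2 * (r * s) := fun x hx => by
    rw [abs_lt]; constructor <;> linarith [hx.1, hx.2]
  have hre : ∀ x ∈ Set.Icc (s - 1 / 1000000 * r * s) s,
      (H x).re = RCLike.re (inner 𝕜 (output B ψ x) u) := fun x hx => by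
    rw [hH x (hin x hx), inner_output]
  have hBu : ‖B u‖ ≤ b := (hB u).trans (mul_le_of_le_one_right hb0.le hu)
  have key := abs_re_le_of_measure (q := 1 / 1000000) (c := s) hrs hHd
    (M := C / s * b * ‖(ψ : WithLp 2 (X × X)).fst‖)
    (fun z hz => (hHb z hz).trans (by gcongr)) n (by norm_num) (by norm_num) hε (A := A)
    (by rwa [← mul_assoc]) (by rwa [← mul_assoc]) (fun x hx => by
      rw [hre x (hA hx)]
      refine (RCLike.abs_re_le_norm _).trans ((norm_inner_le_norm _ _).trans ?_)
      exact (mul_le_of_le_one_right (norm_nonneg _) hu).trans (hb x hx)) (y := y)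
    (by rwa [← mul_assoc])
  rw [hre y hy] at key
  refine (le_abs_self _).trans (key.trans_eq ?_)
  rw [show (100 * (1 / 1000000) : ℝ) = 1 / 10000 by norm_num]
  ring

/-- One step of the telescoping argument. -/
theorem IsAnalytic.exists_observability_step (hS : S.IsAnalytic) (B : U →L[𝕜] S.Xneg) {d k : ℝ}
    (hd : 0 < d) (hobs : S.IsObservable B d k) :
    ∃ κ δ D c₁ c₂ : ℝ, 0 < κ ∧ κ < 1 ∧ 0 < δ ∧ 0 ≤ D ∧ 0 < c₁ ∧ 0 ≤ c₂ ∧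
      ∀ (n : ℕ) (φ : S.adjointDomain) (t L : ℝ), 0 ≤ t → 0 < L → L < δ → ∀ A, MeasurableSet A →
        A ⊆ Set.Icc (t + L - κ * L) (t + L) → ENNReal.ofReal (κ * L / 2) ≤ volume A →
        ‖(S.op (t + L).toNNReal).adjoint (φ : WithLp 2 (X × X)).fst‖ ≤
          Real.exp (D / L ^ k) / L * (100 ^ n * c₁ * (∫ x in A, ‖output B φ x‖) +
            c₂ * (1 / 10000) ^ n * ‖(S.op t.toNNReal).adjoint (φ : WithLp 2 (X × X)).fst‖) := by
  obtain ⟨κ, δ, C, hκ0, hκ1, hδ, hC, hprop⟩ := hS.exists_norm_output_le_of_measure B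
  refine ⟨κ, min δ 1, d / κ ^ k, 4 / κ, C, hκ0, hκ1, by positivity, by positivity, by positivity,
    hC, fun n φ t L ht hL hLδ A hAm hA hv => ?_⟩
  have hL1 : L < 1 := hLδ.trans_le (min_le_right _ _)
  have hκL : 0 < κ * L := by positivity
  have hκL' : κ * L < L := by nlinarith
  set I := ∫ x in A, ‖output B φ x‖ with hI
  have hI0 : 0 ≤ I := integral_nonneg fun _ => norm_nonneg _
  have hAT : A ⊆ Set.Ioc (0 : ℝ) ((t + L).toNNReal : ℝ) := fun x hx => by
    rw [Real.coe_toNNReal _ (by linarith)]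
    exact ⟨by linarith [(hA hx).1], (hA hx).2⟩
  -- This keeps measure κL/4, exactly the quarter required by the propagation of smallness.
  have hch := ofReal_half_le_volume_le_average hAm (hS.integrableOn_norm_output B φ hAm hAT)
    (fun x => norm_nonneg _) (m := κ * L / 2) (by positivity) hv
  rw [← hI] at hch
  set A' := {x ∈ A | ‖output B φ x‖ ≤ 2 / (κ * L / 2) * I} with hA'
  set ψ := S.adjointOp t.toNNReal φ with hψ
  have hshift : ∀ x : ℝ, 0 ≤ x → output B ψ x = output B φ (t + x) := fun x hx => by
    rw [add_comm, output_add_time B φ hx ht]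
  obtain ⟨G, hG⟩ : ∃ G, G = 100 ^ n * (2 / (κ * L / 2) * I) +
      C / L * (1 / 10000) ^ n * ‖(ψ : WithLp 2 (X × X)).fst‖ := ⟨_, rfl⟩
  have hG0 : 0 ≤ G := by rw [hG]; positivity
  have hbound : ∀ y ∈ Set.Icc (L - κ * L) L, ‖output B φ (t + y)‖ ≤ G := by
    intro y hy
    rw [← hshift y (by linarith [hy.1]), hG]
    refine hprop n ψ L _ hL (hLδ.trans_le (min_le_left _ _)) (by positivity)
      ((fun x => t + x) ⁻¹' A') (fun x hx => ?_) ?_ (fun x hx => ?_) y hy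
    · have := hA hx.1
      exact ⟨by linarith [this.1], by linarith [this.2]⟩
    · rw [measure_preimage_add]
      rwa [show κ * L / 4 = κ * L / 2 / 2 by ring]
    · have h1 := hA hx.1
      rw [hshift x (by linarith [h1.1])]
      exact hx.2
  -- The assumed inequality is used on the last window of length κL only, where the output is now
  -- bounded by `G`; hence D = d/κ^k.
  set ψ' := S.adjointOp (t + L - κ * L).toNNReal φ with hψ'
  have hO := hobs ψ' (κ * L).toNNReal (Real.toNNReal_pos.2 hκL)
    (Real.toNNReal_le_one.2 (by linarith))
  rw [Real.coe_toNNReal _ hκL.le] at hO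
  have hint : ∫ s in (0 : ℝ)..κ * L, ‖S.adjointControl B (S.adjointOp s.toNNReal ψ')‖ ^ 2 ≤ G ^ 2 := by
    have h1 : ‖∫ s in (0 : ℝ)..κ * L, ‖S.adjointControl B (S.adjointOp s.toNNReal ψ')‖ ^ 2‖ ≤
        G ^ 2 * |κ * L - 0| := by
      refine intervalIntegral.norm_integral_le_of_norm_le_const fun s hs => ?_
      rw [Set.uIoc_of_le hκL.le] at hs
      have h2 := hbound (L - κ * L + s) ⟨by linarith [hs.1], by linarith [hs.2]⟩
      rw [show t + (L - κ * L + s) = s + (t + L - κ * L) by ring,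
        output_add_time B φ hs.1.le (by linarith)] at h2
      rw [Real.norm_of_nonneg (by positivity)]
      exact pow_le_pow_left₀ (norm_nonneg _) h2 2
    rw [sub_zero, abs_of_pos hκL] at h1
    refine (le_abs_self _).trans (h1.trans ?_)
    exact mul_le_of_le_one_right (by positivity) (by linarith)
  have hexp : d / (κ * L) ^ k = d / κ ^ k / L ^ k := by
    rw [Real.mul_rpow hκ0.le hL.le, div_div]
  set E := Real.exp (d / κ ^ k / L ^ k) with hE
  have hE1 : 1 ≤ E := Real.one_le_exp (by positivity)
  have hsem : (S.op (κ * L).toNNReal).adjoint (ψ' : WithLp 2 (X × X)).fst =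
      (S.op (t + L).toNNReal).adjoint (φ : WithLp 2 (X × X)).fst := by
    rw [← adjointOp_fst, ← adjointOp_fst, hψ', ← adjointOp_add,
      ← Real.toNNReal_add hκL.le (by linarith)]
    rw [show κ * L + (t + L - κ * L) = t + L by ring]
  rw [hsem, hexp, ← hE] at hO
  have hfin : ‖(S.op (t + L).toNNReal).adjoint (φ : WithLp 2 (X × X)).fst‖ ≤ E * G := by
    refine le_of_sq_le_sq (hO.trans ?_) (by positivity)
    calc E * _ ≤ E * G ^ 2 := by gcongr
      _ ≤ E * (E * G ^ 2) := le_mul_of_one_le_left (by positivity) hE1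
      _ = _ := by ring
  refine hfin.trans_eq ?_
  rw [hG, hψ, adjointOp_fst]
  have e1 : 2 / (κ * L / 2) = 4 / κ / L := by field_simp; norm_num
  rw [e1]
  ring

/-- Observability from a set of times of positive measure, with the `L¹` norm in time. -/
theorem IsAnalytic.exists_observability_of_measure (hS : S.IsAnalytic) (B : U →L[𝕜] S.Xneg)
    {d k : ℝ} (hd : 0 < d) (hk : 0 < k) (hobs : S.IsObservable B d k) {E : Set ℝ}
    (hE : MeasurableSet E) (hE0 : volume E ≠ 0) {T : ℝ≥0} (hET : E ⊆ Set.Ioo 0 (T : ℝ)) :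
    ∃ C : ℝ, 0 < C ∧ ∀ φ : S.adjointDomain,
      ‖(S.op T).adjoint (φ : WithLp 2 (X × X)).fst‖ ≤ C * ∫ t in E, ‖output B φ t‖ := by
  obtain ⟨κ, δ, D, c₁, c₂, hκ0, hκ1, hδ, hD, hc₁, hc₂, hstep⟩ := hS.exists_observability_step B hd hobs
  obtain ⟨ρ, hρ⟩ : ∃ ρ : ℝ, ρ = (1 / 2) ^ (1 / k) := ⟨_, rfl⟩
  have hρ0 : 0 < ρ := by rw [hρ]; positivity
  have hρ1 : ρ < 1 := by rw [hρ]; exact Real.rpow_lt_one (by norm_num) (by norm_num) (by positivity)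
  have hρk : ρ ^ k = 1 / 2 := by
    rw [hρ, ← Real.rpow_mul (by norm_num), one_div_mul_cancel hk.ne', Real.rpow_one]
  have h1ρ : 0 < 1 - ρ := by linarith
  -- With this density, E misses at most κL/2 of [l, τ m], where L = τ m - τ (m + 1), and so fills
  -- at least half of the window (τ m - κL, τ m].
  obtain ⟨l, hlE, a₀, ha₀, hdens⟩ := exists_density_point hE hE0 (η := κ * (1 - ρ) / 2) (by positivity)
  have hl := hET hlE
  have hTl : 0 < (T : ℝ) - l := by linarith [hl.2]
  obtain ⟨a, ha⟩ : ∃ a, a = min (a₀ / 2) (min ((T : ℝ) - l) (δ / 2)) := ⟨_, rfl⟩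
  have ha0 : 0 < a := by rw [ha]; positivity
  have haa₀ : a < a₀ := by
    have : a ≤ a₀ / 2 := by rw [ha]; exact min_le_left _ _
    have h2 : (0 : ℝ) < a₀ := ha₀
    linarith
  have haT : l + a ≤ T := by
    have : a ≤ T - l := by rw [ha]; exact (min_le_right _ _).trans (min_le_left _ _)
    linarith
  have haδ : a < δ := by
    have : a ≤ δ / 2 := by rw [ha]; exact (min_le_right _ _).trans (min_le_right _ _)
    linarith
  obtain ⟨w, n, hw0, hwlim, hw⟩ := exists_telescoping_weights (c₂ := c₂) (L := a * (1 - ρ)) hD hc₁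
    (by positivity) hρ0 hρ1 hρk
  obtain ⟨CS, hCS, hSb⟩ := S.exists_norm_op_le T
  have hadj : ∀ t ≤ T, ∀ x, ‖(S.op t).adjoint x‖ ≤ CS * ‖x‖ := fun t ht x =>
    ((S.op t).adjoint.le_opNorm x).trans (by
      rw [LinearIsometryEquiv.norm_map]
      gcongr
      exact hSb t ht)
  set τ : ℕ → ℝ := fun m => l + a * ρ ^ m with hτ
  have hpow : ∀ m : ℕ, ρ ^ m ≤ 1 := fun m => pow_le_one₀ hρ0.le hρ1.le
  have hτT : ∀ m, τ m ≤ T := fun m => by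
    have : a * ρ ^ m ≤ a := mul_le_of_le_one_right ha0.le (hpow m)
    simp only [hτ]; linarith
  have hτ0 : ∀ m, 0 < τ m := fun m => by
    have : 0 < a * ρ ^ m := by positivity
    simp only [hτ]; linarith [hl.1]
  have hτs : ∀ m, τ m = τ (m + 1) + a * (1 - ρ) * ρ ^ m := fun m => by
    simp only [hτ, pow_succ]; ring
  have hLpos : ∀ m : ℕ, 0 < a * (1 - ρ) * ρ ^ m := fun m => by positivity
  have hτanti : ∀ m, τ (m + 1) ≤ τ m := fun m => by linarith [hτs m, hLpos m]
  have hint : ∀ (φ : S.adjointDomain) (A : Set ℝ), A ⊆ E → MeasurableSet A →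
      IntegrableOn (fun t => ‖output B φ t‖) A := fun φ A hA hAm =>
    hS.integrableOn_norm_output B φ hAm ((hA.trans hET).trans Set.Ioo_subset_Ioc_self)
  have hone : ∀ (φ : S.adjointDomain) (m : ℕ),
      w m * ‖(S.op (τ m).toNNReal).adjoint (φ : WithLp 2 (X × X)).fst‖ ≤
        (∫ t in E ∩ Set.Ioc (τ (m + 1)) (τ m), ‖output B φ t‖) +
          w (m + 1) * ‖(S.op (τ (m + 1)).toNNReal).adjoint (φ : WithLp 2 (X × X)).fst‖ := by
    intro φ m
    set L := a * (1 - ρ) * ρ ^ m with hL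
    have hL0 : 0 < L := hLpos m
    have hLa : L ≤ a := by
      have h1 : (1 - ρ) * ρ ^ m ≤ 1 := mul_le_one₀ (by linarith) (by positivity) (hpow m)
      rw [hL, mul_assoc]
      exact mul_le_of_le_one_right ha0.le h1
    have hκL : κ * L < L := by nlinarith
    set A := E ∩ Set.Ioc (τ m - κ * L) (τ m) with hA
    have hAm : MeasurableSet A := hE.inter measurableSet_Ioc
    have hvol : ENNReal.ofReal (κ * L / 2) ≤ volume A := by
      have h1 := hdens (a * ρ ^ m) (by positivity)
        ((mul_le_of_le_one_right ha0.le (hpow m)).trans_lt haa₀)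
      rw [show κ * (1 - ρ) / 2 * (a * ρ ^ m) = κ * L / 2 by rw [hL]; ring] at h1
      have h2 : Set.Ioc (τ m - κ * L) (τ m) ⊆ A ∪ (Set.Icc l (l + a * ρ ^ m) \ E) := fun x hx => by
        by_cases hxE : x ∈ E
        · exact Or.inl ⟨hxE, hx⟩
        · refine Or.inr ⟨⟨?_, hx.2⟩, hxE⟩
          have h3 : l ≤ τ (m + 1) := by
            have : 0 < a * ρ ^ (m + 1) := by positivity
            simp only [hτ]; linarith
          linarith [hx.1, hτs m]
      have h4 := (measure_mono h2).trans (measure_union_le (μ := volume) _ _)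
      rw [Real.volume_Ioc, show τ m - (τ m - κ * L) = κ * L / 2 + κ * L / 2 by ring,
        ENNReal.ofReal_add (by positivity) (by positivity)] at h4
      exact ENNReal.le_of_add_le_add_right (by simp) (h4.trans (by gcongr))
    have hst := hstep (n m) φ (τ (m + 1)) L (hτ0 _).le hL0 (hLa.trans_lt haδ) A hAm
      (by rw [← hτs m]; exact Set.inter_subset_right.trans Set.Ioc_subset_Icc_self) hvol
    rw [← hτs m] at hst
    have hsub : A ⊆ E ∩ Set.Ioc (τ (m + 1)) (τ m) := fun x hx =>
      ⟨hx.1, by linarith [hx.2.1, hτs m], hx.2.2⟩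
    have hmono : (∫ t in A, ‖output B φ t‖) ≤
        ∫ t in E ∩ Set.Ioc (τ (m + 1)) (τ m), ‖output B φ t‖ :=
      setIntegral_mono_set (hint φ _ Set.inter_subset_left (hE.inter measurableSet_Ioc))
        (Eventually.of_forall fun _ => norm_nonneg _) hsub.eventuallyLE
    obtain ⟨hw1, hw2⟩ := hw m
    rw [← hL] at hw1 hw2
    have hI0 : 0 ≤ ∫ t in A, ‖output B φ t‖ := integral_nonneg fun _ => norm_nonneg _
    set I := ∫ t in A, ‖output B φ t‖
    set F := ‖(S.op (τ (m + 1)).toNNReal).adjoint (φ : WithLp 2 (X × X)).fst‖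
    calc _ ≤ w m * (Real.exp (D / L ^ k) / L * (100 ^ n m * c₁ * I +
            c₂ * (1 / 10000) ^ n m * F)) := mul_le_mul_of_nonneg_left hst (hw0 m).le
      _ = w m * (Real.exp (D / L ^ k) / L * (100 ^ n m * c₁)) * I +
          w m * (Real.exp (D / L ^ k) / L * (c₂ * (1 / 10000) ^ n m)) * F := by ring
      _ ≤ 1 * I + w (m + 1) * F := by gcongr
      _ ≤ _ := by rw [one_mul]; gcongr
  have hind : ∀ (φ : S.adjointDomain) (m : ℕ),
      w 0 * ‖(S.op (τ 0).toNNReal).adjoint (φ : WithLp 2 (X × X)).fst‖ ≤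
        (∫ t in E ∩ Set.Ioc (τ m) (τ 0), ‖output B φ t‖) +
          w m * ‖(S.op (τ m).toNNReal).adjoint (φ : WithLp 2 (X × X)).fst‖ := by
    intro φ m
    induction m with
    | zero => simp
    | succ m ih =>
      have hanti : τ m ≤ τ 0 := antitone_nat_of_succ_le hτanti (Nat.zero_le m)
      have hsplit : E ∩ Set.Ioc (τ (m + 1)) (τ 0) =
          (E ∩ Set.Ioc (τ (m + 1)) (τ m)) ∪ (E ∩ Set.Ioc (τ m) (τ 0)) := by
        rw [← Set.inter_union_distrib_left, Set.Ioc_union_Ioc_eq_Ioc (hτanti m) hanti]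
      have hdisj : Disjoint (E ∩ Set.Ioc (τ (m + 1)) (τ m)) (E ∩ Set.Ioc (τ m) (τ 0)) :=
        Disjoint.mono Set.inter_subset_right Set.inter_subset_right
          (Set.Ioc_disjoint_Ioc_of_le le_rfl)
      rw [hsplit, setIntegral_union hdisj (hE.inter measurableSet_Ioc)
        (hint φ _ Set.inter_subset_left (hE.inter measurableSet_Ioc))
        (hint φ _ Set.inter_subset_left (hE.inter measurableSet_Ioc))]
      linarith [hone φ m]
  have hlim : ∀ φ : S.adjointDomain,
      w 0 * ‖(S.op (τ 0).toNNReal).adjoint (φ : WithLp 2 (X × X)).fst‖ ≤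
        ∫ t in E, ‖output B φ t‖ := by
    intro φ
    -- The semigroup is bounded on [0, T], so the remainder vanishes together with the weights.
    have hto : Tendsto (fun m => (∫ t in E, ‖output B φ t‖) +
        w m * (CS * ‖(φ : WithLp 2 (X × X)).fst‖)) atTop (𝓝 (∫ t in E, ‖output B φ t‖)) := by
      simpa using (hwlim.mul_const (CS * ‖(φ : WithLp 2 (X × X)).fst‖)).const_add
        (∫ t in E, ‖output B φ t‖)
    refine ge_of_tendsto' hto fun m => (hind φ m).trans ?_
    refine add_le_add ?_ (mul_le_mul_of_nonneg_left ?_ (hw0 m).le)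
    · exact setIntegral_mono_set (hint φ _ subset_rfl hE)
        (Eventually.of_forall fun _ => norm_nonneg _) Set.inter_subset_left.eventuallyLE
    · exact hadj _ (Real.toNNReal_le_iff_le_coe.2 (hτT m)) _
  refine ⟨CS / w 0, div_pos hCS (hw0 0), fun φ => ?_⟩
  have hτ0T : (τ 0).toNNReal ≤ T := Real.toNNReal_le_iff_le_coe.2 (hτT 0)
  have hfac : (S.op T).adjoint (φ : WithLp 2 (X × X)).fst =
      (S.op (T - (τ 0).toNNReal)).adjoint ((S.op (τ 0).toNNReal).adjoint
        (φ : WithLp 2 (X × X)).fst) := by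
    rw [← adjointOp_fst, ← adjointOp_fst, ← adjointOp_fst, ← adjointOp_add,
      tsub_add_cancel_of_le hτ0T]
  rw [hfac]
  refine (hadj _ tsub_le_self _).trans ?_
  rw [div_mul_eq_mul_div, mul_div_assoc]
  gcongr
  rw [le_div_iff₀ (hw0 0), mul_comm]
  exact hlim φ

end C0Semigroup
end

/-! ### Functionals bounded in the L¹ norm -/

section duality
variable {𝕜 : Type*} [RCLike 𝕜] {α : Type*} [MeasurableSpace α] {μ : Measure α} [IsFiniteMeasure μ]
  {U : Type*} [NormedAddCommGroup U] [InnerProductSpace 𝕜 U]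

theorem exists_integral_norm_le (μ : Measure α) [IsFiniteMeasure μ] : ∃ c : ℝ, 0 ≤ c ∧
    ∀ f : Lp U 2 μ, ∫ x, ‖f x‖ ∂μ ≤ c * ‖f‖ := by
  refine ⟨(μ Set.univ ^ (1 / (1 : ENNReal).toReal - 1 / (2 : ENNReal).toReal)).toReal,
    ENNReal.toReal_nonneg, fun f => ?_⟩
  have h1 := eLpNorm_le_eLpNorm_mul_rpow_measure_univ (μ := μ) (f := f) (p := 1) (q := 2)
    (by norm_num) (Lp.aestronglyMeasurable f)
  have hfin : μ Set.univ ^ (1 / (1 : ENNReal).toReal - 1 / (2 : ENNReal).toReal) ≠ ⊤ :=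
    ENNReal.rpow_ne_top_of_nonneg (by norm_num) (measure_ne_top _ _)
  have h2 : ∫ x, ‖f x‖ ∂μ = (eLpNorm f 1 μ).toReal := by
    rw [integral_norm_eq_lintegral_enorm (Lp.aestronglyMeasurable f), eLpNorm_one_eq_lintegral_enorm]
  rw [h2, Lp.norm_def, mul_comm, ← ENNReal.toReal_mul]
  exact ENNReal.toReal_mono (ENNReal.mul_ne_top (Lp.eLpNorm_ne_top f) hfin) h1

/-- Testing with `w` cut off to {‖w‖ > C} gives ∫‖w‖² ≤ C∫‖w‖ over that set, which is impossible
unless it is null. -/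
theorem ae_norm_le_of_inner_le {w : Lp U 2 μ} {C : ℝ} (hC : 0 ≤ C)
    (h : ∀ f : Lp U 2 μ, ‖inner 𝕜 w f‖ ≤ C * ∫ x, ‖f x‖ ∂μ) : ∀ᵐ x ∂μ, ‖w x‖ ≤ C := by
  set A : Set α := {x | C < ‖w x‖} with hA
  have hAm : MeasurableSet A := measurableSet_lt measurable_const (Lp.stronglyMeasurable w).norm.measurable
  have hmem : MemLp (A.indicator w) 2 μ := (Lp.memLp w).indicator hAm
  have hint1 : Integrable (fun x => ‖w x‖) μ := ((Lp.memLp w).integrable (by norm_num)).norm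
  have hint2 : Integrable (fun x => ‖w x‖ ^ 2) μ := (Lp.memLp w).integrable_norm_pow (by norm_num)
  have h1 := h (hmem.toLp _)
  have e1 : inner 𝕜 w (hmem.toLp _) = ((∫ x in A, ‖w x‖ ^ 2 ∂μ : ℝ) : 𝕜) := by
    rw [L2.inner_def, ← integral_indicator hAm, ← integral_ofReal]
    refine integral_congr_ae ?_
    filter_upwards [hmem.coeFn_toLp] with x hx
    rw [hx]
    by_cases hxA : x ∈ A
    · simp [hxA, inner_self_eq_norm_sq_to_K]
    · simp [hxA]
  have e2 : ∫ x, ‖hmem.toLp _ x‖ ∂μ = ∫ x in A, ‖w x‖ ∂μ := by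
    rw [← integral_indicator hAm]
    refine integral_congr_ae ?_
    filter_upwards [hmem.coeFn_toLp] with x hx
    rw [hx]
    by_cases hxA : x ∈ A
    · simp [hxA]
    · simp [hxA]
  rw [e1, e2, RCLike.norm_ofReal, abs_of_nonneg (integral_nonneg fun _ => by positivity),
    ← integral_const_mul] at h1
  have h2 : ∫ x in A, (‖w x‖ ^ 2 - C * ‖w x‖) ∂μ ≤ 0 := by
    rw [integral_sub hint2.integrableOn (hint1.const_mul C).integrableOn]
    linarith
  have hpos : ∀ x ∈ A, 0 < ‖w x‖ ^ 2 - C * ‖w x‖ := fun x hx => by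
    have : C < ‖w x‖ := hx
    nlinarith
  have h3 : μ A = 0 := by
    by_contra hne
    have h4 := (setIntegral_pos_iff_support_of_nonneg_ae (μ := μ) (s := A)
      (f := fun x => ‖w x‖ ^ 2 - C * ‖w x‖)
      ((ae_restrict_mem hAm).mono fun x hx => (hpos x hx).le)
      (hint2.sub (hint1.const_mul C)).integrableOn).2 ?_
    · linarith
    · refine lt_of_lt_of_le (pos_iff_ne_zero.2 hne) (measure_mono fun x hx => ⟨?_, hx⟩)
      exact (hpos x hx).ne'
  rw [ae_iff]
  simpa [hA] using h3

variable [CompleteSpace U]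

/-- Functionals which are bounded for the `L¹` norm are represented by bounded functions. -/
theorem exists_bounded_representation {V : Type*} [AddCommGroup V] [Module 𝕜 V]
    (Φ : V →ₗ[𝕜] Lp U 2 μ) (l : V →ₗ[𝕜] 𝕜) {C : ℝ} (hC : 0 ≤ C)
    (h : ∀ v, ‖l v‖ ≤ C * ∫ x, ‖Φ v x‖ ∂μ) :
    ∃ w : α → U, StronglyMeasurable w ∧ (∀ x, ‖w x‖ ≤ C) ∧
      ∀ v, l v = ∫ x, inner 𝕜 (w x) (Φ v x) ∂μ := by
  have hmem : ∀ f : Lp U 2 μ, MemLp f 1 μ := fun f => (Lp.memLp f).mono_exponent (by norm_num)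
  let j : Lp U 2 μ →ₗ[𝕜] Lp U 1 μ :=
    { toFun := fun f => (hmem f).toLp f
      map_add' := fun f g => by
        rw [← MemLp.toLp_add, MemLp.toLp_eq_toLp_iff]
        exact Lp.coeFn_add f g
      map_smul' := fun c f => by
        rw [RingHom.id_apply, ← MemLp.toLp_const_smul, MemLp.toLp_eq_toLp_iff]
        exact Lp.coeFn_smul c f }
  have hj : ∀ f, ‖j f‖ = ∫ x, ‖f x‖ ∂μ := fun f => by
    rw [L1.norm_eq_integral_norm]
    refine integral_congr_ae ?_
    filter_upwards [(hmem f).coeFn_toLp] with x hx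
    change ‖(hmem f).toLp f x‖ = _
    rw [hx]
  obtain ⟨g, hg, hgl⟩ := exists_dual_of_norm_le (j.comp Φ) l hC fun v => by
    rw [LinearMap.comp_apply, hj]; exact h v
  obtain ⟨c, hc, hcb⟩ := exists_integral_norm_le (U := U) μ
  have hb : ∀ f, ‖(g.toLinearMap.comp j) f‖ ≤ C * ∫ x, ‖f x‖ ∂μ := fun f => by
    rw [← hj]
    exact (g.le_opNorm _).trans (by gcongr)
  -- The measure is finite, so the extension to L¹ restricts to L², where Riesz supplies a
  -- representative; its sup bound comes from the L¹ estimate.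
  let G : Lp U 2 μ →L[𝕜] 𝕜 := (g.toLinearMap.comp j).mkContinuous (C * c) fun f =>
    (hb f).trans (by rw [mul_assoc]; gcongr; exact hcb f)
  set w := (InnerProductSpace.toDual 𝕜 (Lp U 2 μ)).symm G with hw
  have hwf : ∀ f, inner 𝕜 w f = g (j f) := fun f => InnerProductSpace.toDual_symm_apply
  have hwC : ∀ᵐ x ∂μ, ‖w x‖ ≤ C := ae_norm_le_of_inner_le (𝕜 := 𝕜) hC fun f => by
    rw [hwf]; exact hb f
  have hAm : MeasurableSet {x | ‖w x‖ ≤ C} :=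
    measurableSet_le (Lp.stronglyMeasurable w).norm.measurable measurable_const
  refine ⟨{x | ‖w x‖ ≤ C}.indicator w, (Lp.stronglyMeasurable w).indicator hAm, fun x => ?_,
    fun v => ?_⟩
  · by_cases hx : ‖w x‖ ≤ C
    · rwa [Set.indicator_of_mem (by exact hx)]
    · rw [Set.indicator_of_notMem (by exact hx), norm_zero]; exact hC
  · rw [← hgl v, LinearMap.comp_apply, ← hwf, L2.inner_def]
    refine integral_congr_ae ?_
    filter_upwards [hwC] with x hx
    rw [Set.indicator_of_mem (by exact hx)]

end duality

/-! ### The input map as a pairing with the outputs -/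

noncomputable section

/-- Evaluation at φ is a bounded functional, so it passes through the Bochner integral. Continuity
is asked only on the open interval because S(τ - t) need not be norm continuous at t = τ. -/
theorem integral_comp_apply {𝕜 D : Type*} [RCLike 𝕜] [NormedAddCommGroup D] [NormedSpace 𝕜 D]
    {a b : ℝ} (hab : a ≤ b) {ξ : ℝ → D →L⋆[𝕜] 𝕜} {A : ℝ → D →L[𝕜] D} {g : ℝ → ℝ} {C : ℝ}
    (hξ : AEStronglyMeasurable ξ (volume.restrict (Set.Ioc a b)))
    (hA : ContinuousOn A (Set.Ioo a b)) (hg : IntegrableOn g (Set.Ioc a b)) (hb : ∀ t, ‖ξ t‖ ≤ g t)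
    (hC : ∀ t ∈ Set.Ioc a b, ‖A t‖ ≤ C) (φ : D) :
    IntervalIntegrable (fun t => ξ t (A t φ)) volume a b ∧
      (∫ t in a..b, (ξ t).comp (A t)) φ = ∫ t in a..b, ξ t (A t φ) := by
  have hcont : Continuous fun p : (D →L⋆[𝕜] 𝕜) × (D →L[𝕜] D) => p.1.comp p.2 := by
    refine continuous_iff_continuousAt.2 fun p => tendsto_iff_norm_sub_tendsto_zero.2 ?_
    have h : Continuous fun q : (D →L⋆[𝕜] 𝕜) × (D →L[𝕜] D) =>
        ‖q.1 - p.1‖ * ‖q.2‖ + ‖p.1‖ * ‖q.2 - p.2‖ := by fun_prop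
    refine squeeze_zero (fun _ => norm_nonneg _) (fun q => ?_) (h.tendsto' p 0 (by simp))
    have e : q.1.comp q.2 - p.1.comp p.2 = (q.1 - p.1).comp q.2 + p.1.comp (q.2 - p.2) := by
      ext x; simp
    rw [e]
    exact (norm_add_le _ _).trans (add_le_add (ContinuousLinearMap.opNorm_comp_le _ _)
      (ContinuousLinearMap.opNorm_comp_le _ _))
  have hA' : AEStronglyMeasurable A (volume.restrict (Set.Ioc a b)) := by
    rw [← Measure.restrict_congr_set Ioo_ae_eq_Ioc]
    exact hA.aestronglyMeasurable measurableSet_Ioo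
  have hint : IntervalIntegrable (fun t => (ξ t).comp (A t)) volume a b := by
    rw [intervalIntegrable_iff_integrableOn_Ioc_of_le hab]
    refine Integrable.mono' (g := fun t => g t * C) (hg.mul_const _)
      (hcont.comp_aestronglyMeasurable (hξ.prodMk hA')) ?_
    filter_upwards [ae_restrict_mem measurableSet_Ioc] with t ht
    refine (ContinuousLinearMap.opNorm_comp_le _ _).trans ?_
    exact mul_le_mul (hb t) (hC t ht) (norm_nonneg _) ((norm_nonneg _).trans (hb t))
  let l : (D →L⋆[𝕜] 𝕜) →ₗ[𝕜] 𝕜 :=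
    { toFun := fun η => η φ
      map_add' := fun _ _ => rfl
      map_smul' := fun _ _ => rfl }
  let L : (D →L⋆[𝕜] 𝕜) →L[𝕜] 𝕜 := l.mkContinuous ‖φ‖ fun η => by
    rw [mul_comm]; exact η.le_opNorm φ
  refine ⟨?_, (L.intervalIntegral_comp_comm hint).symm⟩
  rw [intervalIntegrable_iff] at hint ⊢
  exact L.integrable_comp hint

namespace C0Semigroup

variable {𝕜 : Type*} [RCLike 𝕜] {X : Type*} [NormedAddCommGroup X] [InnerProductSpace 𝕜 X]
  [CompleteSpace X] {S : C0Semigroup 𝕜 X} {U : Type*} [NormedAddCommGroup U]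
  [InnerProductSpace 𝕜 U]

theorem embed_apply (x : X) (φ : S.adjointDomain) :
    S.embed x φ = inner 𝕜 (φ : WithLp 2 (X × X)).fst x := rfl

/-- Hahn-Banach extends the conjugate of ξ from the first components to all of `X`, where Riesz
applies. -/
theorem exists_embed_eq {ξ : S.Xneg} {C : ℝ} (hC : 0 ≤ C)
    (h : ∀ φ : S.adjointDomain, ‖ξ φ‖ ≤ C * ‖(φ : WithLp 2 (X × X)).fst‖) :
    ∃ x : X, ‖x‖ ≤ C ∧ S.embed x = ξ := by
  let l : S.adjointDomain →ₗ[𝕜] 𝕜 :=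
    { toFun := fun p => starRingEnd 𝕜 (ξ p)
      map_add' := fun p q => by rw [map_add, map_add]
      map_smul' := fun c p => by simp }
  let F : S.adjointDomain →ₗ[𝕜] X :=
    { toFun := fun p => (p : WithLp 2 (X × X)).fst
      map_add' := fun p q => rfl
      map_smul' := fun c p => rfl }
  obtain ⟨g, hg, hgl⟩ := exists_dual_of_norm_le F l hC fun v => by
    change ‖starRingEnd 𝕜 (ξ v)‖ ≤ _
    rw [RCLike.norm_conj]
    exact h v
  refine ⟨(InnerProductSpace.toDual 𝕜 X).symm g, by rwa [LinearIsometryEquiv.norm_map], ?_⟩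
  ext φ
  have h1 : inner 𝕜 ((InnerProductSpace.toDual 𝕜 X).symm g) (φ : WithLp 2 (X × X)).fst =
      starRingEnd 𝕜 (ξ φ) := by
    rw [InnerProductSpace.toDual_symm_apply]
    exact hgl φ
  rw [embed_apply, ← inner_conj_symm, h1, RCLike.conj_conj]

variable [CompleteSpace U]

theorem IsAnalytic.intervalIntegrable_and_inputMap_apply (hS : S.IsAnalytic) (B : U →L[𝕜] S.Xneg) (τ : ℝ≥0)
    {f : ℝ → U} (hf : IntegrableOn f (Set.Ioc 0 (τ : ℝ))) (φ : S.adjointDomain) :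
    IntervalIntegrable (fun t => inner 𝕜 (output B φ ((τ : ℝ) - t)) (f t)) volume 0 (τ : ℝ) ∧
      S.inputMap B τ f φ = ∫ t in (0 : ℝ)..τ, inner 𝕜 (output B φ ((τ : ℝ) - t)) (f t) := by
  obtain ⟨b, hb0, hB⟩ := exists_norm_control_le B
  obtain ⟨C, hC, hCS⟩ := S.exists_norm_op_le τ
  have hop : ContinuousOn (fun t : ℝ => S.adjointOp ((τ : ℝ) - t).toNNReal) (Set.Ioo 0 (τ : ℝ)) :=
    hS.continuousOn_adjointOp.comp (by fun_prop) fun t ht =>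
      Real.toNNReal_pos.2 (by linarith [ht.2])
  have h2 : AEStronglyMeasurable (fun t : ℝ => B (f t)) (volume.restrict (Set.Ioc 0 (τ : ℝ))) :=
    B.continuous.comp_aestronglyMeasurable hf.aestronglyMeasurable
  have h3 : ∀ t ∈ Set.Ioc (0 : ℝ) τ, ‖S.adjointOp ((τ : ℝ) - t).toNNReal‖ ≤ C := fun t ht =>
    (norm_adjointOp_le _).trans (hCS _ (Real.toNNReal_le_iff_le_coe.2 (by linarith [ht.1])))
  have key := integral_comp_apply (𝕜 := 𝕜) (D := S.adjointDomain) τ.coe_nonneg (ξ := fun t => B (f t))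
    (A := fun t => S.adjointOp ((τ : ℝ) - t).toNNReal) (g := fun t => b * ‖f t‖) (C := C)
    h2 hop (hf.norm.const_mul b) (fun t => hB (f t)) h3 φ
  simp only [inner_output]
  exact key

theorem IsAnalytic.intervalIntegrable_inner_output (hS : S.IsAnalytic) (B : U →L[𝕜] S.Xneg)
    (τ : ℝ≥0) {f : ℝ → U} (hf : IntegrableOn f (Set.Ioc 0 (τ : ℝ))) (φ : S.adjointDomain) :
    IntervalIntegrable (fun t => inner 𝕜 (output B φ ((τ : ℝ) - t)) (f t)) volume 0 (τ : ℝ) :=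
  (hS.intervalIntegrable_and_inputMap_apply B τ hf φ).1

theorem IsAnalytic.inputMap_apply (hS : S.IsAnalytic) (B : U →L[𝕜] S.Xneg) (τ : ℝ≥0) {f : ℝ → U}
    (hf : IntegrableOn f (Set.Ioc 0 (τ : ℝ))) (φ : S.adjointDomain) :
    S.inputMap B τ f φ = ∫ t in (0 : ℝ)..τ, inner 𝕜 (output B φ ((τ : ℝ) - t)) (f t) :=
  (hS.intervalIntegrable_and_inputMap_apply B τ hf φ).2

theorem IsAnalytic.memLp_output (hS : S.IsAnalytic) (B : U →L[𝕜] S.Xneg) (φ : S.adjointDomain)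
    (T : ℝ≥0) (p : ENNReal) {A : Set ℝ} (hA : MeasurableSet A) (hAT : A ⊆ Set.Ioo 0 (T : ℝ)) :
    MemLp (fun s => output B φ ((T : ℝ) - s)) p (volume.restrict A) := by
  have : IsFiniteMeasure (volume.restrict A) :=
    isFiniteMeasure_restrict.2 (ne_top_of_le_ne_top (by simp) (measure_mono hAT))
  obtain ⟨C, hC, hb⟩ := exists_norm_output_le B φ T
  have hc : ContinuousOn (fun s => output B φ ((T : ℝ) - s)) A :=
    (hS.continuousOn_output B φ).comp (by fun_prop) fun s hs => by
      have := (hAT hs).2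
      simpa using this
  refine MemLp.of_bound (hc.aestronglyMeasurable hA) C ?_
  filter_upwards [ae_restrict_mem hA] with s hs
  exact hb _ (by linarith [(hAT hs).1])

/-- Boundedness of the input map of an admissible control operator. -/
theorem IsAnalytic.exists_inputMap_le (hS : S.IsAnalytic) {B : U →L[𝕜] S.Xneg}
    (hB : S.IsAdmissibleControl B) : ∃ (τ : ℝ≥0) (K : ℝ), 0 < τ ∧ 0 < K ∧
      ∀ (f : ℝ → U), MemLp f 2 (volume.restrict (Set.Ioo (0 : ℝ) τ)) → ∀ φ : S.adjointDomain,
        ‖S.inputMap B τ f φ‖ ≤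
          K * (eLpNorm f 2 (volume.restrict (Set.Ioo (0 : ℝ) τ))).toReal *
            ‖(φ : WithLp 2 (X × X)).fst‖ := by
  obtain ⟨τ, hτ, hadm⟩ := hB
  set μ := volume.restrict (Set.Ioo (0 : ℝ) τ) with hμ
  have hG : ∀ φ, MemLp (fun s => output B φ ((τ : ℝ) - s)) 2 μ := fun φ =>
    hS.memLp_output B φ τ 2 measurableSet_Ioo subset_rfl
  let l : S.adjointDomain → Lp U 2 μ →L[𝕜] 𝕜 := fun φ => innerSL 𝕜 ((hG φ).toLp _)
  have hl : ∀ (f : ℝ → U) (hf : MemLp f 2 μ) φ, l φ (hf.toLp f) = S.inputMap B τ f φ := by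
    intro f hf φ
    have hfi : IntegrableOn f (Set.Ioc 0 (τ : ℝ)) := by
      rw [integrableOn_Ioc_iff_integrableOn_Ioo]
      exact hf.integrable (by norm_num)
    rw [hS.inputMap_apply B τ hfi φ, intervalIntegral.integral_of_le τ.coe_nonneg,
      integral_Ioc_eq_integral_Ioo]
    change inner 𝕜 ((hG φ).toLp _) (hf.toLp f) = _
    rw [L2.inner_def]
    refine integral_congr_ae ?_
    filter_upwards [(hG φ).coeFn_toLp, hf.coeFn_toLp] with s h1 h2
    rw [h1, h2]
  have hrep : ∀ f : Lp U 2 μ, ∃ x : X, ∀ φ, l φ f = inner 𝕜 (φ : WithLp 2 (X × X)).fst x := by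
    intro f
    obtain ⟨x, hx⟩ := hadm f (Lp.memLp f)
    refine ⟨x, fun φ => ?_⟩
    rw [← embed_apply, hx, ← hl f (Lp.memLp f), Lp.toLp_coeFn]
  -- Admissibility gives pointwise boundedness of the functionals f ↦ ⟨Ψ_τ f, φ⟩/‖φ‖ on L², the norm
  -- of φ being that of `X`.
  obtain ⟨K, hK⟩ := banach_steinhaus
    (g := fun φ : S.adjointDomain => ((‖(φ : WithLp 2 (X × X)).fst‖⁻¹ : ℝ) : 𝕜) • l φ) fun f => by
      obtain ⟨x, hx⟩ := hrep f
      refine ⟨‖x‖, fun φ => ?_⟩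
      rw [smul_apply, norm_smul, RCLike.norm_ofReal, abs_of_nonneg (by positivity), hx]
      rcases eq_or_ne (‖(φ : WithLp 2 (X × X)).fst‖) 0 with h0 | h0
      · rw [h0]; simp
      · rw [inv_mul_le_iff₀ (by positivity)]
        exact norm_inner_le_norm _ _
  refine ⟨τ, max K 1, hτ, by positivity, fun f hf φ => ?_⟩
  rw [← hl f hf, ← Lp.norm_toLp f hf]
  rcases eq_or_ne (‖(φ : WithLp 2 (X × X)).fst‖) 0 with h0 | h0
  · obtain ⟨x, hx⟩ := hrep (hf.toLp f)
    rw [hx, norm_eq_zero.1 h0, inner_zero_left, norm_zero]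
    positivity
  · have h1 := (ContinuousLinearMap.le_opNorm _ (hf.toLp f)).trans
      (mul_le_mul_of_nonneg_right (hK φ) (norm_nonneg _))
    rw [smul_apply, norm_smul, RCLike.norm_ofReal, abs_of_nonneg (by positivity),
      inv_mul_le_iff₀ (by positivity)] at h1
    refine h1.trans ?_
    rw [mul_comm]
    gcongr
    exact le_max_left _ _

omit [CompleteSpace U] in
theorem integrableOn_of_bounded {f : ℝ → U} (hf : StronglyMeasurable f) {M : ℝ}
    (hM : ∀ s, ‖f s‖ ≤ M) (a b : ℝ) : IntegrableOn f (Set.Ioc a b) :=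
  Integrable.of_bound hf.aestronglyMeasurable M (Eventually.of_forall hM)

/-- Over short times, bounded controls reach small elements of `X`. -/
theorem IsAnalytic.exists_embed_eq_inputMap (hS : S.IsAnalytic) {B : U →L[𝕜] S.Xneg}
    (hB : S.IsAdmissibleControl B) {f : ℝ → U} (hf : StronglyMeasurable f) {M : ℝ}
    (hM : ∀ s, ‖f s‖ ≤ M) : ∃ (τ : ℝ≥0) (K : ℝ), 0 < τ ∧ 0 ≤ K ∧ ∀ δ ≤ τ,
      ∃ x : X, ‖x‖ ≤ K * Real.sqrt δ ∧ S.embed x = S.inputMap B δ f := by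
  obtain ⟨τ, K, hτ, hK, hbound⟩ := hS.exists_inputMap_le hB
  have hM0 : 0 ≤ M := (norm_nonneg _).trans (hM 0)
  refine ⟨τ, K * M, hτ, by positivity, fun δ hδ => exists_embed_eq (by positivity) fun φ => ?_⟩
  have hδ' : (δ : ℝ) ≤ τ := hδ
  have hδ0 : (0 : ℝ) ≤ δ := δ.2
  -- Delaying `f` to the last δ of [0, τ] gives Ψ_δ f = Ψ_τ g, and the L² norm of `g` is at most
  -- M√δ.
  set g : ℝ → U := (Set.Ioi ((τ : ℝ) - δ)).indicator fun s => f (s - (τ - δ)) with hg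
  have hfs : StronglyMeasurable fun s => f (s - (τ - δ)) :=
    hf.comp_measurable (measurable_id.sub_const _)
  have hgm : StronglyMeasurable g := hfs.indicator measurableSet_Ioi
  have hgM : ∀ s, ‖g s‖ ≤ M := fun s => (norm_indicator_le_norm_self _ _).trans (hM _)
  have hgL : MemLp g 2 (volume.restrict (Set.Ioo (0 : ℝ) τ)) :=
    MemLp.of_bound hgm.aestronglyMeasurable M (Eventually.of_forall hgM)
  have hnorm : (eLpNorm g 2 (volume.restrict (Set.Ioo (0 : ℝ) τ))).toReal ≤ M * Real.sqrt δ := by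
    rw [hg, eLpNorm_indicator_eq_eLpNorm_restrict measurableSet_Ioi,
      Measure.restrict_restrict measurableSet_Ioi]
    have h1 := eLpNorm_le_of_ae_bound (p := 2) (f := fun s => f (s - (τ - δ)))
      (μ := volume.restrict (Set.Ioi ((τ : ℝ) - δ) ∩ Set.Ioo (0 : ℝ) τ)) (C := M)
      (Eventually.of_forall fun s => hM _)
    have h2 : volume.restrict (Set.Ioi ((τ : ℝ) - δ) ∩ Set.Ioo (0 : ℝ) τ) Set.univ ≤
        ENNReal.ofReal δ := by
      rw [Measure.restrict_apply_univ]
      refine (measure_mono (t := Set.Ioc ((τ : ℝ) - δ) τ) fun s hs => ⟨hs.1, hs.2.2.le⟩).trans ?_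
      rw [Real.volume_Ioc]; simp
    have h3 : eLpNorm (fun s => f (s - (τ - δ))) 2
        (volume.restrict (Set.Ioi ((τ : ℝ) - δ) ∩ Set.Ioo (0 : ℝ) τ)) ≤
        ENNReal.ofReal (M * Real.sqrt δ) := by
      refine h1.trans ?_
      rw [mul_comm, ENNReal.ofReal_mul hM0, Real.sqrt_eq_rpow,
        ← ENNReal.ofReal_rpow_of_nonneg hδ0 (by norm_num), ENNReal.toReal_ofNat, one_div]
      gcongr
    exact ENNReal.toReal_le_of_le_ofReal (by positivity) h3
  have hmid : (τ : ℝ) - δ ∈ Set.uIcc (0 : ℝ) τ := by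
    rw [Set.uIcc_of_le τ.coe_nonneg]; constructor <;> linarith
  have heq : S.inputMap B δ f φ = S.inputMap B τ g φ := by
    rw [hS.inputMap_apply B δ (integrableOn_of_bounded hf hM _ _),
      hS.inputMap_apply B τ (integrableOn_of_bounded hgm hgM _ _),
      ← intervalIntegral.integral_add_adjacent_intervals (a := 0) (b := (τ : ℝ) - δ) (c := τ)]
    · have h1 : ∫ t in (0 : ℝ)..(τ - δ), inner 𝕜 (output B φ ((τ : ℝ) - t)) (g t) = 0 := by
        refine (intervalIntegral.integral_congr fun t ht => ?_).trans intervalIntegral.integral_zero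
        rw [Set.uIcc_of_le (by linarith)] at ht
        simp only [hg]
        rw [Set.indicator_of_notMem (by simpa using ht.2), inner_zero_right]
      have h2 : ∫ t in ((τ : ℝ) - δ)..τ, inner 𝕜 (output B φ ((τ : ℝ) - t)) (g t) =
          ∫ t in ((τ : ℝ) - δ)..τ, inner 𝕜 (output B φ ((δ : ℝ) - (t - (τ - δ)))) (f (t - (τ - δ))) := by
        refine intervalIntegral.integral_congr_ae (Eventually.of_forall fun t ht => ?_)
        rw [Set.uIoc_of_le (by linarith)] at ht
        simp only [hg]
        rw [Set.indicator_of_mem (by exact ht.1)]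
        congr 2
        ring
      rw [h1, h2, zero_add, intervalIntegral.integral_comp_sub_right
        (fun t => inner 𝕜 (output B φ ((δ : ℝ) - t)) (f t))]
      simp
    · exact (hS.intervalIntegrable_inner_output B τ (integrableOn_of_bounded hgm hgM _ _) φ).mono_set
        (Set.uIcc_subset_uIcc_left hmid)
    · exact (hS.intervalIntegrable_inner_output B τ (integrableOn_of_bounded hgm hgM _ _) φ).mono_set
        (Set.uIcc_subset_uIcc_right hmid)
  rw [heq]
  refine (hbound g hgL φ).trans ?_
  calc _ ≤ K * (M * Real.sqrt δ) * ‖(φ : WithLp 2 (X × X)).fst‖ := by gcongr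
    _ = _ := by ring

/-- Bounded controls, supported in a set of positive measure, from an observability inequality. -/
theorem IsAnalytic.exists_control (hS : S.IsAnalytic) (B : U →L[𝕜] S.Xneg) {T : ℝ≥0} {E : Set ℝ}
    (hE : MeasurableSet E) (hET : E ⊆ Set.Ioo 0 (T : ℝ)) {x : X} {C : ℝ} (hC : 0 ≤ C)
    (h : ∀ φ : S.adjointDomain, ‖inner 𝕜 (φ : WithLp 2 (X × X)).fst x‖ ≤
      C * ∫ s in E, ‖output B φ ((T : ℝ) - s)‖) :
    ∃ w : ℝ → U, StronglyMeasurable w ∧ (∀ s, ‖w s‖ ≤ C) ∧ ∀ φ : S.adjointDomain,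
      ∫ s in E, inner 𝕜 (output B φ ((T : ℝ) - s)) (w s) =
        inner 𝕜 (φ : WithLp 2 (X × X)).fst x := by
  have : IsFiniteMeasure (volume.restrict E) :=
    isFiniteMeasure_restrict.2 (ne_top_of_le_ne_top (by simp) (measure_mono hET))
  have hmem : ∀ φ, MemLp (fun s => output B φ ((T : ℝ) - s)) 2 (volume.restrict E) := fun φ =>
    hS.memLp_output B φ T 2 hE hET
  let Φ : S.adjointDomain →ₗ[𝕜] Lp U 2 (volume.restrict E) :=
    { toFun := fun φ => (hmem φ).toLp _
      map_add' := fun φ ψ => by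
        rw [← MemLp.toLp_add, MemLp.toLp_eq_toLp_iff]
        refine Eventually.of_forall fun s => ?_
        simp only [output, map_add, adjointControl_add, Pi.add_apply]
      map_smul' := fun c φ => by
        rw [RingHom.id_apply, ← MemLp.toLp_const_smul, MemLp.toLp_eq_toLp_iff]
        refine Eventually.of_forall fun s => ?_
        simp only [output, map_smul, adjointControl_smul, Pi.smul_apply] }
  let l : S.adjointDomain →ₗ[𝕜] 𝕜 :=
    { toFun := fun φ => inner 𝕜 x (φ : WithLp 2 (X × X)).fst
      map_add' := fun φ ψ => inner_add_right _ _ _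
      map_smul' := fun c φ => inner_smul_right _ _ _ }
  obtain ⟨w, hw, hwC, hwl⟩ := exists_bounded_representation Φ l hC fun φ => by
    change ‖inner 𝕜 x (φ : WithLp 2 (X × X)).fst‖ ≤ _
    rw [norm_inner_symm]
    refine (h φ).trans_eq ?_
    congr 1
    refine integral_congr_ae ?_
    filter_upwards [(hmem φ).coeFn_toLp] with s hs
    change _ = ‖(hmem φ).toLp _ s‖
    rw [hs]
  refine ⟨w, hw, hwC, fun φ => ?_⟩
  have h1 : inner 𝕜 x (φ : WithLp 2 (X × X)).fst = _ := hwl φ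
  rw [← inner_conj_symm, h1, ← integral_conj]
  refine integral_congr_ae ?_
  filter_upwards [(hmem φ).coeFn_toLp] with s hs
  change _ = starRingEnd 𝕜 (inner 𝕜 (w s) ((hmem φ).toLp _ s))
  rw [inner_conj_symm, hs]

end C0Semigroup
end

/-! ### Reaching the target earlier -/

noncomputable section
namespace C0Semigroup

variable {𝕜 : Type*} [RCLike 𝕜] {X : Type*} [NormedAddCommGroup X] [InnerProductSpace 𝕜 X]
  [CompleteSpace X] {S : C0Semigroup 𝕜 X} {U : Type*} [NormedAddCommGroup U]
  [InnerProductSpace 𝕜 U]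

theorem exists_bounded_ae_eq {f : ℝ → U} {M : ℝ} (hM : 0 ≤ M) (hf : f ∈ controls U M) :
    ∃ g : ℝ → U, StronglyMeasurable g ∧ (∀ s, ‖g s‖ ≤ M) ∧
      f =ᵐ[volume.restrict (Set.Ioi (0 : ℝ))] g := by
  obtain ⟨hm, hb⟩ := hf
  have hA : MeasurableSet {s | ‖hm.mk f s‖ ≤ M} :=
    measurableSet_le hm.stronglyMeasurable_mk.norm.measurable measurable_const
  refine ⟨{s | ‖hm.mk f s‖ ≤ M}.indicator (hm.mk f), hm.stronglyMeasurable_mk.indicator hA,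
    fun s => ?_, ?_⟩
  · by_cases hs : ‖hm.mk f s‖ ≤ M
    · rwa [Set.indicator_of_mem (by exact hs)]
    · rw [Set.indicator_of_notMem (by exact hs), norm_zero]; exact hM
  · filter_upwards [hb, hm.ae_eq_mk] with s h1 h2
    rw [Set.indicator_of_mem, h2]
    change ‖hm.mk f s‖ ≤ M
    rwa [← h2]

theorem inputMap_congr {B : U →L[𝕜] S.Xneg} {f g : ℝ → U} (τ : ℝ≥0)
    (h : f =ᵐ[volume.restrict (Set.Ioi (0 : ℝ))] g) : S.inputMap B τ f = S.inputMap B τ g := by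
  refine intervalIntegral.integral_congr_ae ?_
  filter_upwards [(ae_restrict_iff' measurableSet_Ioi).1 h] with t ht htm
  rw [Set.uIoc_of_le τ.coe_nonneg] at htm
  rw [ht htm.1]

/-- The set where ‖g‖ < M is a countable union over ε = 1/(n+1). Starting at ε instead of 0 leaves
room for the time gain before the set begins. -/
theorem exists_measure_ne_zero {g : ℝ → U} {M T : ℝ} (hg : ∀ s, ‖g s‖ ≤ M)
    (h : ¬ ∀ᵐ t ∂(volume.restrict (Set.Ioo (0 : ℝ) T)), ‖g t‖ = M) :
    ∃ ε : ℝ, 0 < ε ∧ volume {s ∈ Set.Ioo ε T | ‖g s‖ ≤ M - ε} ≠ 0 := by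
  by_contra! hcon
  refine h ?_
  rw [ae_restrict_iff' measurableSet_Ioo, ae_iff]
  refine measure_mono_null (t := ⋃ n : ℕ, {s ∈ Set.Ioo (1 / ((n : ℝ) + 1)) T |
    ‖g s‖ ≤ M - 1 / ((n : ℝ) + 1)}) (fun s hs => ?_)
    (measure_iUnion_null fun n => hcon _ (by positivity))
  obtain ⟨hs1, hs2⟩ := Classical.not_imp.1 hs
  have hlt : 0 < M - ‖g s‖ := sub_pos.2 (lt_of_le_of_ne (hg s) hs2)
  obtain ⟨n, hn⟩ := exists_nat_one_div_lt (lt_min hs1.1 hlt)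
  have h1 := hn.trans_le (min_le_left _ _)
  have h2 := hn.trans_le (min_le_right _ _)
  exact Set.mem_iUnion.2 ⟨n, ⟨h1, hs1.2⟩, by linarith⟩

variable [CompleteSpace U]

/-- A control which is not bang-bang can be modified so as to reach the target earlier. -/
theorem IsAnalytic.exists_earlier (hS : S.IsAnalytic) {B : U →L[𝕜] S.Xneg}
    (hB : S.IsAdmissibleControl B) {d k : ℝ} (hd : 0 < d) (hk : 0 < k)
    (hobs : S.IsObservable B d k) {z₀ z₁ : X} {M : ℝ} {T : ℝ≥0} {f : ℝ → U}
    (hf : StronglyMeasurable f) (hM : ∀ s, ‖f s‖ ≤ M) (hz : S.state B z₀ f T = S.embed z₁)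
    (hbb : ¬ ∀ᵐ t ∂(volume.restrict (Set.Ioo (0 : ℝ) T)), ‖f t‖ = M) :
    ∃ t ∈ S.reachTimes B z₀ z₁ M, t < T := by
  have hM0 : 0 ≤ M := (norm_nonneg _).trans (hM 0)
  obtain ⟨ε, hε, hvol⟩ := exists_measure_ne_zero hM hbb
  set E := {s ∈ Set.Ioo ε (T : ℝ) | ‖f s‖ ≤ M - ε} with hE
  have hEm : MeasurableSet E :=
    measurableSet_Ioo.inter (measurableSet_le hf.norm.measurable measurable_const)
  have hEε : E ⊆ Set.Ioo ε (T : ℝ) := fun s hs => hs.1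
  have hET : E ⊆ Set.Ioo 0 (T : ℝ) := fun s hs => ⟨hε.trans hs.1.1, hs.1.2⟩
  obtain ⟨s₀, hs₀⟩ := nonempty_of_measure_ne_zero hvol
  have hεT : ε < T := (hEε hs₀).1.trans (hEε hs₀).2
  lift ε to ℝ≥0 using hε.le
  have hεT' : ε < T := by exact_mod_cast hεT
  have hmp := Measure.measurePreserving_sub_left (volume : Measure ℝ) (T : ℝ)
  have hemb : MeasurableEmbedding fun t : ℝ => (T : ℝ) - t :=
    (Homeomorph.subLeft (T : ℝ)).measurableEmbedding
  -- The reflection t ↦ T - t puts E ⊆ (ε, T) inside (0, T - ε), so observability holds already at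
  -- the final time T - ε.
  obtain ⟨C, hC, hobsE⟩ := hS.exists_observability_of_measure B hd hk hobs
    (E := (fun t : ℝ => (T : ℝ) - t) ⁻¹' E) (hEm.preimage hmp.measurable)
    (by rwa [hmp.measure_preimage hEm.nullMeasurableSet]) (T := T - ε) (fun t ht => by
      have h1 := hEε ht
      rw [NNReal.coe_sub hεT'.le]
      exact ⟨by linarith [h1.2], by linarith [h1.1]⟩)
  have hobsE' : ∀ φ : S.adjointDomain, ‖(S.op (T - ε)).adjoint (φ : WithLp 2 (X × X)).fst‖ ≤
      C * ∫ s in E, ‖output B φ ((T : ℝ) - s)‖ := fun φ => by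
    refine (hobsE φ).trans_eq ?_
    congr 1
    rw [← hmp.setIntegral_preimage_emb hemb (fun s => ‖output B φ ((T : ℝ) - s)‖) E]
    simp only [sub_sub_cancel]
  obtain ⟨CS, hCS, hSb⟩ := S.exists_norm_op_le T
  obtain ⟨τ, K, hτ, hK, hinp⟩ := hS.exists_embed_eq_inputMap hB hf hM
  -- choice of the time gain
  have hlim : Tendsto (fun δ : ℝ≥0 => C * (CS * (‖S.op δ z₀ - z₀‖ + K * Real.sqrt δ)))
      (𝓝[>] 0) (𝓝 0) := by
    have hc : Continuous fun δ : ℝ≥0 => C * (CS * (‖S.op δ z₀ - z₀‖ + K * Real.sqrt δ)) := by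
      have := S.continuous_orbit z₀
      fun_prop
    exact (hc.tendsto' 0 0 (by simp [S.op_zero])).mono_left nhdsWithin_le_nhds
  have hev : ∀ᶠ δ : ℝ≥0 in 𝓝[>] 0, 0 < δ ∧ δ < min ε τ ∧
      C * (CS * (‖S.op δ z₀ - z₀‖ + K * Real.sqrt δ)) < ε := by
    filter_upwards [self_mem_nhdsWithin,
      nhdsWithin_le_nhds (Iio_mem_nhds (lt_min (by exact_mod_cast hε) hτ : 0 < min ε τ)),
      hlim.eventually_lt_const hε] with δ h1 h2 h3 using ⟨h1, h2, h3⟩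
  obtain ⟨δ, hδ0, hδ1, hδ2⟩ := hev.exists
  have hδε : δ < ε := hδ1.trans_le (min_le_left _ _)
  have hδT : δ < T := hδε.trans hεT'
  have hδ0' : (0 : ℝ) < δ := hδ0
  have hδε' : (δ : ℝ) < ε := hδε
  have hδT' : (δ : ℝ) < T := hδT
  obtain ⟨x, hxn, hx⟩ := hinp δ (hδ1.le.trans (min_le_right _ _))
  -- The original state at time δ is S(δ)z₀ + x, while the new trajectory has z₀ there; the
  -- discrepancy at the end is S(T - δ)(S(δ)z₀ + x - z₀) = S(T - ε)y.
  set y := S.op (ε - δ) (S.op δ z₀ + x - z₀) with hy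
  have hyn : C * ‖y‖ ≤ ε := by
    refine le_trans ?_ hδ2.le
    gcongr
    refine ((S.op (ε - δ)).le_opNorm _).trans ?_
    gcongr
    · exact hSb _ (tsub_le_self.trans hεT'.le)
    · rw [add_sub_right_comm]
      exact (norm_add_le _ _).trans (by gcongr)
  obtain ⟨w, hwm, hwε, hwE⟩ := hS.exists_control B hEm hET (x := S.op (T - ε) y) (C := ε) hε.le
    fun φ => by
      rw [← ContinuousLinearMap.adjoint_inner_left]
      refine (norm_inner_le_norm _ _).trans ?_
      have hI : 0 ≤ ∫ s in E, ‖output B φ ((T : ℝ) - s)‖ := integral_nonneg fun _ => norm_nonneg _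
      calc _ ≤ (C * ∫ s in E, ‖output B φ ((T : ℝ) - s)‖) * ‖y‖ := by gcongr; exact hobsE' φ
        _ = (C * ‖y‖) * ∫ s in E, ‖output B φ ((T : ℝ) - s)‖ := by ring
        _ ≤ _ := by gcongr
  -- The correction has size at most ε and acts only where ‖f‖ ≤ M - ε. Since E lies beyond ε > δ,
  -- the shift by δ loses none of it.
  set v : ℝ → U := fun s => f s + E.indicator w s with hv
  have hvm : StronglyMeasurable v := hf.add (hwm.indicator hEm)
  have hvM : ∀ s, ‖v s‖ ≤ M := fun s => by
    by_cases hs : s ∈ E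
    · simp only [hv, Set.indicator_of_mem hs]
      have h1 : ‖f s‖ ≤ M - ε := hs.2
      linarith [norm_add_le (f s) (w s), hwε s]
    · simp only [hv, Set.indicator_of_notMem hs, add_zero]
      exact hM s
  have hgm : StronglyMeasurable fun s => v (s + δ) := hvm.comp_measurable (measurable_id.add_const _)
  refine ⟨T - δ, ⟨tsub_pos_of_lt hδT, fun s => v (s + δ), ⟨hgm.aestronglyMeasurable,
    Eventually.of_forall fun s => hvM _⟩, ?_⟩, tsub_lt_self (hδ0.trans hδT) hδ0⟩
  ext φ
  have hcoe : ((T - δ : ℝ≥0) : ℝ) = T - δ := NNReal.coe_sub hδT.le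
  have hmid : (δ : ℝ) ∈ Set.uIcc (0 : ℝ) T := by
    rw [Set.uIcc_of_le T.coe_nonneg]; exact ⟨hδ0'.le, hδT'.le⟩
  have hfi := hS.intervalIntegrable_inner_output B T (integrableOn_of_bounded hf hM 0 T) φ
  have hwi := hS.intervalIntegrable_inner_output B T
    (integrableOn_of_bounded (hwm.indicator hEm) (M := ε)
      (fun s => (norm_indicator_le_norm_self _ _).trans (hwε s)) 0 T) φ
  have hfi2 := hfi.mono_set (Set.uIcc_subset_uIcc_right hmid)
  have hwi2 := hwi.mono_set (Set.uIcc_subset_uIcc_right hmid)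
  have hsplit := intervalIntegral.integral_add_adjacent_intervals
    (hfi.mono_set (Set.uIcc_subset_uIcc_left hmid)) hfi2
  -- the state of the given control
  have hst := congrArg (fun ξ : S.Xneg => ξ φ) hz
  have hst' : S.embed (S.op T z₀) φ + S.inputMap B T f φ = S.embed z₁ φ := hst
  rw [hS.inputMap_apply B T (integrableOn_of_bounded hf hM 0 T), ← hsplit] at hst'
  have hfirst : ∫ t in (0 : ℝ)..δ, inner 𝕜 (output B φ ((T : ℝ) - t)) (f t) =
      inner 𝕜 (φ : WithLp 2 (X × X)).fst (S.op (T - δ) x) := by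
    rw [← ContinuousLinearMap.adjoint_inner_left, ← adjointOp_fst, ← embed_apply, hx,
      hS.inputMap_apply B δ (integrableOn_of_bounded hf hM 0 δ)]
    refine intervalIntegral.integral_congr fun t ht => ?_
    rw [Set.uIcc_of_le hδ0'.le] at ht
    have h1 := output_add_time B φ (s := (δ : ℝ) - t) (t := ((T - δ : ℝ≥0) : ℝ))
      (by linarith [ht.2]) (NNReal.coe_nonneg _)
    rw [Real.toNNReal_coe] at h1
    rw [← h1, hcoe]
    congr 2
    ring
  -- the state of the new control
  have hnew : S.inputMap B (T - δ) (fun s => v (s + δ)) φ =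
      (∫ t in (δ : ℝ)..T, inner 𝕜 (output B φ ((T : ℝ) - t)) (f t)) +
        inner 𝕜 (φ : WithLp 2 (X × X)).fst (S.op (T - ε) y) := by
    rw [hS.inputMap_apply B (T - δ) (integrableOn_of_bounded hgm (fun s => hvM _) _ _), hcoe]
    have h1 : ∫ t in (0 : ℝ)..(T - δ), inner 𝕜 (output B φ ((T : ℝ) - δ - t)) (v (t + δ)) =
        ∫ t in (0 : ℝ)..(T - δ), inner 𝕜 (output B φ ((T : ℝ) - (t + δ))) (v (t + δ)) := by
      refine intervalIntegral.integral_congr fun t _ => ?_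
      congr 2
      ring
    rw [h1, intervalIntegral.integral_comp_add_right
      (fun t => inner 𝕜 (output B φ ((T : ℝ) - t)) (v t)), zero_add, sub_add_cancel]
    simp only [hv, inner_add_right]
    rw [intervalIntegral.integral_add hfi2 hwi2]
    congr 1
    rw [← hwE, intervalIntegral.integral_of_le hδT'.le]
    have h2 : ∀ t, inner 𝕜 (output B φ ((T : ℝ) - t)) (E.indicator w t) =
        E.indicator (fun t => inner 𝕜 (output B φ ((T : ℝ) - t)) (w t)) t := fun t => by
      by_cases ht : t ∈ E
      · simp [ht]
      · simp [ht]
    simp only [h2]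
    rw [setIntegral_indicator hEm]
    congr 2
    exact Set.inter_eq_right.2 fun t ht => ⟨hδε'.trans (hEε ht).1, (hEε ht).2.le⟩
  change S.embed (S.op (T - δ) z₀) φ + S.inputMap B (T - δ) (fun s => v (s + δ)) φ = S.embed z₁ φ
  have hcomp : ∀ a b : ℝ≥0, ∀ u : X, S.op a (S.op b u) = S.op (a + b) u := fun a b u => by
    rw [S.op_add]; rfl
  have e1 : S.op (T - ε) y = S.op T z₀ + S.op (T - δ) x - S.op (T - δ) z₀ := by
    rw [hy, hcomp, tsub_add_tsub_cancel hεT'.le hδε.le, map_sub, map_add, hcomp,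
      tsub_add_cancel_of_le hδT.le]
  rw [hnew, ← hst', hfirst, e1, inner_sub_right, inner_add_right]
  simp only [embed_apply]
  ring

end C0Semigroup
end

theorem theorem3p1 {𝕜 : Type*} [RCLike 𝕜]
    {X : Type*} [NormedAddCommGroup X] [InnerProductSpace 𝕜 X] [CompleteSpace X]
    {U : Type*} [NormedAddCommGroup U] [InnerProductSpace 𝕜 U] [CompleteSpace U]
    (S : C0Semigroup 𝕜 X) (hS : S.IsAnalytic)
    (B : U →L[𝕜] S.Xneg) (hB : S.IsAdmissibleControl B)
    (d k : ℝ) (hd : 0 < d) (hk : 0 < k) (hobs : S.IsObservable B d k)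
    (z₀ z₁ : X) (hz : z₁ ≠ z₀) (M : ℝ) (hM : 0 < M) :
    S.BangBang B z₀ z₁ M := by
  intro T f hf
  obtain ⟨hT, hfc, hstate⟩ := hf
  obtain ⟨g, hg, hgM, hfg⟩ := C0Semigroup.exists_bounded_ae_eq hM.le hfc
  have hstate' : S.state B z₀ g T = S.embed z₁ := by
    rw [← hstate, C0Semigroup.state, C0Semigroup.state, C0Semigroup.inputMap_congr T hfg]
  have hgbb : ∀ᵐ t ∂(volume.restrict (Set.Ioo (0 : ℝ) T)), ‖g t‖ = M := by
    by_contra hbb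
    obtain ⟨t, ht, htT⟩ := hS.exists_earlier hB hd hk hobs hg hgM hstate' hbb
    exact absurd (hT.1 ht) (not_le.2 htT)
  have hfg' : f =ᵐ[volume.restrict (Set.Ioo (0 : ℝ) T)] g :=
    hfg.filter_mono (ae_mono (Measure.restrict_mono (fun t ht => ht.1) le_rfl))
  filter_upwards [hgbb, hfg'] with t h1 h2
  rw [h2, h1]
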